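/- Let $k$ be a field, let $H$ be an affine group scheme over $k$, and let $S$ be a finite group scheme over $k$ which is a (closed) normal subgroup scheme of $H$. Modules are rational modules (comodules over the coordinate algebra), of arbitrary dimension unless otherwise stated; "projective" and "injective" refer to the category of all rational $S$-modules. For an $S$-module $M$ and $n\ge 0$, an $S$-module $N$ is called an $n$-th syzygy $\Omega^n_S(M)$ if $N$ has no nonzero projective direct summand and, for some projective $S$-module $Q$, there is an exact sequence $0\to N\oplus Q\to P_{n-1}\to\cdots\to P_0\to M\to 0$ of $S$-modules with all $P_i$ projective (for $n=0$ this means $M\cong N\oplus Q$). For $n<0$ it is called an $n$-th syzygy $\Omega^{n}_S(M)$ if $N$ has no nonzero projective direct summand and, for some projective $S$-module $Q$, there is an exact sequence $0\to M\to I_0\to\cdots\to I_{-n-1}\to N\oplus Q\to 0$ of $S$-modules with all $I_j$ injective. An $S$-module $N$ stably lifts to $H$ if there are an $H$-module $K$ and a projective $S$-module $Q$ with $K|_S\cong N\oplus Q$. Suppose that there is a projective $S$-module $P$ which lifts to $H$, i.e. is the restriction to $S$ of an $H$-module (again denoted $P$), and that there is a surjective homomorphism of $H$-modules $P\to k$ onto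 the trivial module. Then for every finite-dimensional $H$-module $M$ and every $n\in\mathbb{Z}$, a syzygy $\Omega^n_S(M|_S)$ exists, and every such syzygy stably lifts to $H$. -/

import Mathlib

open scoped TensorProduct

universe u

/-- A rational module for the affine group scheme `Spec A` over the field `k`, where `A` is a
commutative Hopf algebra: a `k`-vector space `V`, of any dimension, with a (right) comodule
structure map `V → V ⊗ A` that is coassociative and counital. -/
structure RatMod (k A : Type u) [Field k] [CommRing A] [HopfAlgebra k A] where
  carrier : Type u
  [addCommGroup : AddCommGroup carrier]
  [module : Module k carrier]
  /-- The comodule structure map. -/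
  coact : carrier →ₗ[k] carrier ⊗[k] A
  coassoc : (TensorProduct.assoc k carrier A A).toLinearMap ∘ₗ coact.rTensor A ∘ₗ coact =
    (Coalgebra.comul (R := k) (A := A)).lTensor carrier ∘ₗ coact
  counit_coact : (Coalgebra.counit (R := k) (A := A)).lTensor carrier ∘ₗ coact =
    (TensorProduct.rid k carrier).symm.toLinearMap

attribute [instance] RatMod.addCommGroup RatMod.module

namespace RatMod

variable {k A B : Type u} [Field k] [CommRing A] [HopfAlgebra k A] [CommRing B] [HopfAlgebra k B]

/-- The linear map `f` is a homomorphism of rational modules. -/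
def IsHom (V W : RatMod k A) (f : V.carrier →ₗ[k] W.carrier) : Prop :=
  W.coact ∘ₗ f = f.rTensor A ∘ₗ V.coact

/-- `V` and `W` are isomorphic as rational modules. -/
def Iso (V W : RatMod k A) : Prop :=
  ∃ e : V.carrier ≃ₗ[k] W.carrier, IsHom V W e.toLinearMap

/-- The trivial one-dimensional module `k`. -/
def triv (k A : Type u) [Field k] [CommRing A] [HopfAlgebra k A] : RatMod k A where
  carrier := k
  coact := (TensorProduct.mk k k A).flip 1
  coassoc := by
    ext
    simp [Bialgebra.comul_one, Algebra.TensorProduct.one_def]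
  counit_coact := by
    ext
    simp

/-- Naturality of the associator in its first argument. -/
theorem assoc_rTensor {V W : Type u} [AddCommGroup V] [Module k V] [AddCommGroup W] [Module k W]
    (f : V →ₗ[k] W) :
    (TensorProduct.assoc k W A A).toLinearMap ∘ₗ (f.rTensor A).rTensor A =
      f.rTensor (A ⊗[k] A) ∘ₗ (TensorProduct.assoc k V A A).toLinearMap := by
  ext
  simp

/-- If `f` intertwines the coaction of `V` with a linear map `ρ`, then `ρ` satisfies the
coassociativity law on the range of `f`. -/
theorem coassoc_comp (V : RatMod k A) {W : Type u} [AddCommGroup W] [Module k W]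
    (ρ : W →ₗ[k] W ⊗[k] A) (f : V.carrier →ₗ[k] W) (h : ρ ∘ₗ f = f.rTensor A ∘ₗ V.coact) :
    ((TensorProduct.assoc k W A A).toLinearMap ∘ₗ ρ.rTensor A ∘ₗ ρ) ∘ₗ f =
      ((Coalgebra.comul (R := k) (A := A)).lTensor W ∘ₗ ρ) ∘ₗ f := by
  have h1 : ρ.rTensor A ∘ₗ f.rTensor A = (f.rTensor A).rTensor A ∘ₗ V.coact.rTensor A := by
    rw [← LinearMap.rTensor_comp, h, LinearMap.rTensor_comp]
  calc ((TensorProduct.assoc k W A A).toLinearMap ∘ₗ ρ.rTensor A ∘ₗ ρ) ∘ₗ f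
      = (TensorProduct.assoc k W A A).toLinearMap ∘ₗ (ρ.rTensor A ∘ₗ f.rTensor A) ∘ₗ V.coact := by
        simp only [LinearMap.comp_assoc, h]
    _ = ((TensorProduct.assoc k W A A).toLinearMap ∘ₗ (f.rTensor A).rTensor A) ∘ₗ
          V.coact.rTensor A ∘ₗ V.coact := by
        rw [h1]
        simp only [LinearMap.comp_assoc]
    _ = f.rTensor (A ⊗[k] A) ∘ₗ (Coalgebra.comul (R := k) (A := A)).lTensor V.carrier ∘ₗ
          V.coact := by
        rw [assoc_rTensor, LinearMap.comp_assoc, V.coassoc]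
    _ = ((Coalgebra.comul (R := k) (A := A)).lTensor W ∘ₗ ρ) ∘ₗ f := by
        rw [LinearMap.comp_assoc, h, ← LinearMap.comp_assoc, ← LinearMap.comp_assoc,
          LinearMap.rTensor_comp_lTensor, LinearMap.lTensor_comp_rTensor]

/-- If `f` intertwines the coaction of `V` with a linear map `ρ`, then `ρ` satisfies the
counit law on the range of `f`. -/
theorem counit_comp (V : RatMod k A) {W : Type u} [AddCommGroup W] [Module k W]
    (ρ : W →ₗ[k] W ⊗[k] A) (f : V.carrier →ₗ[k] W) (h : ρ ∘ₗ f = f.rTensor A ∘ₗ V.coact) :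
    ((Coalgebra.counit (R := k) (A := A)).lTensor W ∘ₗ ρ) ∘ₗ f =
      (TensorProduct.rid k W).symm.toLinearMap ∘ₗ f := by
  rw [LinearMap.comp_assoc, h, ← LinearMap.comp_assoc, LinearMap.lTensor_comp_rTensor,
    ← LinearMap.rTensor_comp_lTensor, LinearMap.comp_assoc, V.counit_coact]
  ext v
  simp

/-- The direct sum of two rational modules. -/
def directSum (V W : RatMod k A) : RatMod k A where
  carrier := V.carrier × W.carrier
  coact := LinearMap.coprod
    ((LinearMap.inl k V.carrier W.carrier).rTensor A ∘ₗ V.coact)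
    ((LinearMap.inr k V.carrier W.carrier).rTensor A ∘ₗ W.coact)
  coassoc := LinearMap.prod_ext
    (coassoc_comp V _ (LinearMap.inl k V.carrier W.carrier) (LinearMap.coprod_inl _ _))
    (coassoc_comp W _ (LinearMap.inr k V.carrier W.carrier) (LinearMap.coprod_inr _ _))
  counit_coact := LinearMap.prod_ext
    (counit_comp V _ (LinearMap.inl k V.carrier W.carrier) (LinearMap.coprod_inl _ _))
    (counit_comp W _ (LinearMap.inr k V.carrier W.carrier) (LinearMap.coprod_inr _ _))

/-- For a homomorphism `π : k[H] → k[S]` of coordinate algebras, that is, a homomorphism of group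
schemes `S → H`, the restriction of an `H`-module to `S`. -/
def res (π : A →ₐc[k] B) (V : RatMod k A) : RatMod k B where
  carrier := V.carrier
  coact := ((π : A →ₗc[k] B) : A →ₗ[k] B).lTensor V.carrier ∘ₗ V.coact
  coassoc := by
    have h1 : (Coalgebra.comul (R := k) (A := B)) ∘ₗ ((π : A →ₗc[k] B) : A →ₗ[k] B) =
        TensorProduct.map ((π : A →ₗc[k] B) : A →ₗ[k] B) ((π : A →ₗc[k] B) : A →ₗ[k] B) ∘ₗ
          Coalgebra.comul :=
      ((π : A →ₗc[k] B).map_comp_comul).symm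
    generalize ((π : A →ₗc[k] B) : A →ₗ[k] B) = p at *
    rw [← LinearMap.comp_assoc V.coact (p.lTensor _) (Coalgebra.comul.lTensor _),
      ← LinearMap.lTensor_comp, h1, LinearMap.lTensor_comp, LinearMap.comp_assoc, ← V.coassoc,
      ← LinearMap.comp_assoc V.coact _ (LinearMap.rTensor B _), LinearMap.rTensor_comp_lTensor]
    rw [← LinearMap.comp_assoc, ← LinearMap.comp_assoc, ← LinearMap.comp_assoc]
    congr 1
    ext v a
    simp only [TensorProduct.AlgebraTensorModule.curry_apply, TensorProduct.curry_apply,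
      LinearMap.restrictScalars_self, LinearMap.comp_apply, LinearEquiv.coe_coe,
      TensorProduct.map_tmul, LinearMap.rTensor_tmul]
    induction V.coact v using TensorProduct.induction_on with
    | zero => simp
    | tmul x y => simp
    | add x y hx hy => simp only [TensorProduct.add_tmul, map_add, hx, hy]
  counit_coact := by
    have h1 : (Coalgebra.counit (R := k) (A := B)) ∘ₗ ((π : A →ₗc[k] B) : A →ₗ[k] B) =
        Coalgebra.counit := (π : A →ₗc[k] B).counit_comp
    rw [← LinearMap.comp_assoc, ← LinearMap.lTensor_comp, h1, V.counit_coact]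

/-- Projective objects in the category of all rational modules. -/
def IsProjective (P : RatMod k A) : Prop :=
  ∀ (X Y : RatMod k A) (g : X.carrier →ₗ[k] Y.carrier) (f : P.carrier →ₗ[k] Y.carrier),
    IsHom X Y g → Function.Surjective g → IsHom P Y f →
      ∃ h : P.carrier →ₗ[k] X.carrier, IsHom P X h ∧ g ∘ₗ h = f

/-- Injective objects in the category of all rational modules. -/
def IsInjective (I : RatMod k A) : Prop :=
  ∀ (X Y : RatMod k A) (g : X.carrier →ₗ[k] Y.carrier) (f : X.carrier →ₗ[k] I.carrier),
    IsHom X Y g → Function.Injective g → IsHom X I f →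
      ∃ h : Y.carrier →ₗ[k] I.carrier, IsHom Y I h ∧ h ∘ₗ g = f

/-- `0 → X → Y → Z → 0` (with the maps `f` and `g`) is a short exact sequence of rational
modules. -/
structure IsShortExact (X Y Z : RatMod k A) (f : X.carrier →ₗ[k] Y.carrier)
    (g : Y.carrier →ₗ[k] Z.carrier) : Prop where
  hom_left : IsHom X Y f
  hom_right : IsHom Y Z g
  injective : Function.Injective f
  exact : Function.Exact f g
  surjective : Function.Surjective g

/-- `N` has no nonzero projective direct summand. -/
def NoProjectiveSummand (N : RatMod k A) : Prop :=
  ∀ X Q : RatMod k A, IsProjective Q → Iso N (directSum X Q) → Subsingleton Q.carrier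

/-- `L` is the `n`-th kernel in a projective resolution of `M`: there is an exact sequence
`0 → L → P_{n-1} → ⋯ → P_0 → M → 0` with all `P_i` projective (for `n = 0`, `L ≅ M`). -/
def IsResolutionKernel : ℕ → RatMod k A → RatMod k A → Prop
  | 0, M, L => Iso M L
  | n + 1, M, L => ∃ (P M' : RatMod k A) (f : M'.carrier →ₗ[k] P.carrier)
      (g : P.carrier →ₗ[k] M.carrier),
      IsProjective P ∧ IsShortExact M' P M f g ∧ IsResolutionKernel n M' L

/-- `L` is the `n`-th cokernel in an injective resolution of `M`: there is an exact sequence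
`0 → M → I_0 → ⋯ → I_{n-1} → L → 0` with all `I_j` injective (for `n = 0`, `L ≅ M`). -/
def IsResolutionCokernel : ℕ → RatMod k A → RatMod k A → Prop
  | 0, M, L => Iso M L
  | n + 1, M, L => ∃ (I M' : RatMod k A) (f : M.carrier →ₗ[k] I.carrier)
      (g : I.carrier →ₗ[k] M'.carrier),
      IsInjective I ∧ IsShortExact M I M' f g ∧ IsResolutionCokernel n M' L

/-- `N` is the syzygy `Ω^n(M)`, `n ∈ ℤ`: `N` has no nonzero projective summands, and up to a
projective summand it is the `n`-th kernel in a projective resolution of `M` when `n ≥ 0`, and the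
`(-n)`-th cokernel in an injective resolution of `M` when `n < 0`. -/
def IsSyzygy (n : ℤ) (M N : RatMod k A) : Prop :=
  NoProjectiveSummand N ∧ ∃ Q : RatMod k A, IsProjective Q ∧
    match n with
    | Int.ofNat m => IsResolutionKernel m M (directSum N Q)
    | Int.negSucc m => IsResolutionCokernel (m + 1) M (directSum N Q)

/-- The `S`-module `N` stably lifts to `H`: there is an `H`-module whose restriction to `S` is
isomorphic to `N ⊕ Q` with `Q` a projective `S`-module. -/
def StablyLifts (π : A →ₐc[k] B) (N : RatMod k B) : Prop :=
  ∃ (K : RatMod k A) (Q : RatMod k B), IsProjective Q ∧ Iso (res π K) (directSum N Q)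

end RatMod

/-- The map `S(R) → H(R)` on `R`-points induced by `π : k[H] → k[S]`. Points are algebra maps to
`R`, with the convolution product as group law. -/
def pointsMap {k A B : Type u} [Field k] [CommRing A] [HopfAlgebra k A] [CommRing B]
    [HopfAlgebra k B] (π : A →ₐc[k] B) (R : Type u) [CommRing R] [Algebra k R]
    (s : WithConv (B →ₐ[k] R)) : WithConv (A →ₐ[k] R) :=
  WithConv.toConv (s.ofConv.comp (π : A →ₐ[k] B))

/-- `π : k[H] → k[S]` exhibits `S` as a normal (closed) subgroup scheme of `H`: it is surjective,
and for every commutative `k`-algebra `R` the subgroup `S(R)` of `H(R)` is normal: for `h ∈ H(R)`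
and `s ∈ S(R)` the product `h s` has the form `t h` with `t ∈ S(R)`, i.e. `h s h⁻¹ ∈ S(R)`. -/
structure IsNormalSubgroupScheme {k A B : Type u} [Field k] [CommRing A] [HopfAlgebra k A]
    [CommRing B] [HopfAlgebra k B] (π : A →ₐc[k] B) : Prop where
  surjective : Function.Surjective π
  normal : ∀ (R : Type u) [CommRing R] [Algebra k R] (h : WithConv (A →ₐ[k] R))
    (s : WithConv (B →ₐ[k] R)), ∃ t : WithConv (B →ₐ[k] R), h * pointsMap π R s = pointsMap π R t * h

/-! The plan is to compute a syzygy of `M` over `S` by a resolution made of `H`-modules. For `n ≥ 0`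
the map `P ⊗ M → M` induced by the augmentation is a surjection of `H`-modules, and `P ⊗ M` is
projective over `S`; its kernel is again an `H`-module, so the step can be repeated. For `n < 0` the
coaction embeds `M` in the `H`-module `M ⊗ k[H]`, and the cokernel is an `H`-module. Either way some
`H`-module `K` restricts to an `n`-th kernel or cokernel of `M`.

By Schanuel's lemma `K|_S` is stably isomorphic to `N ⊕ Q` for every syzygy `N`. To conclude that
`N` is a summand of `K|_S` with projective complement, although `N` may be infinite-dimensional, one
uses that `S`-modules are modules over the Artinian algebra `k[S]*`: an endomorphism of `N` that
factors through a projective is nilpotent when `N` has no projective summand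
(`isNilpotent_of_factors_projective`, `exists_split_of_stably_equiv`).

Two facts about finite group schemes carry the rest. First, `k[S]` is free of rank one over `k[S]*`
(`nonempty_regular_equiv`), proved with an integral built from traces; hence projective and
injective `S`-modules coincide, and by the tensor identity they absorb tensor products. Second,
`k[H]` is injective over the normal subgroup `S`: `exists_total_integral` produces an
`S`-equivariant map `k[S] → k[H]` sending `1` to `1`, which makes `V ⊗ k[H]` a retract of an
injective module (`isInjective_res_cofree`). -/

/-! ### Modules over an Artinian ring: cancelling projective summands -/

section ArtinianRing

variable {R : Type*} [Ring R] [IsArtinianRing R]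

/-- A left ideal of an Artinian ring that is not contained in the radical contains a nonzero
idempotent. -/
theorem exists_idempotent_mem {I : Ideal R} (hI : ¬ I ≤ Ideal.jacobson ⊥) :
    ∃ e ∈ I, e ≠ 0 ∧ e * e = e := by
  -- If `I` consisted of nilpotents, every `1 + y * x` with `x ∈ I` would be a unit, which puts `I`
  -- inside the radical.
  obtain ⟨x, hxI, hx⟩ : ∃ x ∈ I, ¬ IsNilpotent x := by
    by_contra! H
    refine hI fun x hx => Ideal.mem_jacobson_iff.2 fun y => ?_
    obtain ⟨u, hu⟩ := (H _ (I.mul_mem_left y hx)).isUnit_one_add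
    refine ⟨(u⁻¹ : Rˣ), ?_⟩
    have : ((u⁻¹ : Rˣ) : R) * (1 + y * x) = 1 := by rw [← hu, Units.inv_mul]
    rw [Submodule.mem_bot, mul_assoc, ← sub_eq_zero.2 this]
    noncomm_ring
  obtain ⟨n, hn⟩ := IsArtinian.monotone_stabilizes
    (⟨fun n => OrderDual.toDual (Ideal.span {x ^ n}), fun a b hab => by
      obtain ⟨c, rfl⟩ := Nat.exists_eq_add_of_le' hab
      refine OrderDual.toDual_le_toDual.2 ((Ideal.span_singleton_le_iff_mem _).2 ?_)
      rw [pow_add]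
      exact Ideal.mul_mem_left _ _ (Ideal.mem_span_singleton_self _)⟩ :
      ℕ →o (Ideal R)ᵒᵈ)
  -- The exponent `n + 1` keeps `z` in `I` even when `n = 0`.
  set z := x ^ (n + 1) with hz
  have hsq : Ideal.span {z * z} = Ideal.span {z} := by
    have h1 := hn (n + 1) (by omega)
    have h2 := hn (n + 1 + (n + 1)) (by omega)
    rw [hz, ← pow_add]
    exact (h2.symm.trans h1)
  have hz0 : z ≠ 0 := fun h => hx ⟨_, h⟩
  have hzI : z ∈ I := by rw [hz, pow_succ]; exact I.mul_mem_left _ hxI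
  -- Right multiplication by `z` on `Rz`. It is onto because `Rz² = Rz`, hence injective because
  -- `Rz` is Noetherian. A preimage `e` of `z` satisfies `e²z = z = ez`, so `e² = e`.
  let f : Ideal.span {z} →ₗ[R] Ideal.span {z} :=
    ((LinearMap.toSpanSingleton R R z).codRestrict (Ideal.span {z}) fun r =>
      Ideal.mul_mem_left _ r (Ideal.mem_span_singleton_self z)) ∘ₗ (Ideal.span {z}).subtype
  have hf : ∀ y, ((f y : Ideal.span {z}) : R) = y * z := fun y => rfl
  have hsurj : Function.Surjective f := by
    rintro ⟨y, hy⟩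
    rw [← hsq] at hy
    obtain ⟨r, rfl⟩ := Ideal.mem_span_singleton'.1 hy
    exact ⟨⟨r * z, Ideal.mul_mem_left _ r (Ideal.mem_span_singleton_self z)⟩,
      Subtype.ext (by rw [hf, mul_assoc])⟩
  have hinj := IsNoetherian.injective_of_surjective_endomorphism f hsurj
  obtain ⟨⟨e, he⟩, hfe⟩ := hsurj ⟨z, Ideal.mem_span_singleton_self z⟩
  have hez : e * z = z := congrArg Subtype.val hfe
  refine ⟨e, (Ideal.span_singleton_le_iff_mem _).2 hzI he, ?_, ?_⟩
  · rintro rfl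
    exact hz0 (by rw [← hez, zero_mul])
  · have := @hinj ⟨e * e, Ideal.mul_mem_left _ _ he⟩ ⟨e, he⟩ (Subtype.ext (by
      rw [hf, hf, mul_assoc, hez, hez]))
    exact congrArg Subtype.val this

variable {N : Type*} [AddCommGroup N] [Module R N]

/-- If `N` has no nonzero projective direct summand, then linear forms on `N` take values in the
radical. -/
theorem range_le_jacobson
    (hN : ∀ u : N →ₗ[R] N, u ∘ₗ u = u → Module.Projective R (LinearMap.range u) → u = 0)
    (φ : N →ₗ[R] R) : LinearMap.range φ ≤ Ideal.jacobson (⊥ : Ideal R) := by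
  by_contra H
  obtain ⟨e, ⟨n, hn⟩, he0, hee⟩ := exists_idempotent_mem H
  -- Since `φ (e • n) = e`, this is a projection of `N` onto a submodule that `φ` makes a retract of
  -- `R`.
  let u : N →ₗ[R] N := (LinearMap.toSpanSingleton R N (e • n)) ∘ₗ φ
  have hu : ∀ m, u m = φ m • e • n := fun m => rfl
  have hφu : ∀ m, φ (u m) = φ m * e := fun m => by
    rw [hu, map_smul, map_smul, hn, smul_eq_mul, smul_eq_mul, hee]
  have huu : u ∘ₗ u = u := by
    ext m
    rw [LinearMap.comp_apply, hu (u m), hφu, hu, mul_smul, ← mul_smul e e, hee]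
  have hmem : ∀ r : R, r • e • n ∈ LinearMap.range u := fun r =>
    ⟨r • n, by rw [hu, map_smul, hn, smul_eq_mul, mul_smul, ← mul_smul e e, hee]⟩
  have hp : Module.Projective R (LinearMap.range u) := by
    refine Module.Projective.of_split (φ ∘ₗ (LinearMap.range u).subtype)
      ((LinearMap.toSpanSingleton R N (e • n)).codRestrict _ hmem) ?_
    ext ⟨_, m, rfl⟩
    change φ (u m) • e • n = u m
    rw [hφu, mul_smul, ← mul_smul e e, hee, hu]
  have h0 := hN u huu hp
  apply he0
  have h1 := hφu n
  rw [h0, hn, hee, LinearMap.zero_apply, map_zero] at h1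
  exact h1.symm

/-- If `N` has no nonzero projective direct summand, then endomorphisms of `N` that factor through
a projective module are nilpotent. -/
theorem isNilpotent_of_factors_projective
    (hN : ∀ u : N →ₗ[R] N, u ∘ₗ u = u → Module.Projective R (LinearMap.range u) → u = 0)
    {Y : Type*} [AddCommGroup Y] [Module R Y] [Module.Projective R Y] (a : N →ₗ[R] Y)
    (b : Y →ₗ[R] N) : IsNilpotent (b ∘ₗ a : Module.End R N) := by
  obtain ⟨s, hs⟩ := Module.projective_def'.1 (‹Module.Projective R Y›)
  set J := Ideal.jacobson (⊥ : Ideal R) with hJ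
  have : J.IsTwoSided := by rw [hJ]; infer_instance
  -- Dual basis argument: the coordinates of `a n` under the splitting `s` are linear forms on `N`,
  -- so they lie in `J`.
  have key : ∀ n, (b ∘ₗ a) n ∈ J • (⊤ : Submodule R N) := by
    intro n
    have h1 : a n = (s (a n)).sum fun y r => r • y := by
      have := LinearMap.congr_fun hs (a n)
      simpa [Finsupp.linearCombination_apply] using this.symm
    rw [LinearMap.comp_apply, h1, Finsupp.sum, map_sum]
    refine Submodule.sum_mem _ fun y _ => ?_
    rw [map_smul]
    exact Submodule.smul_mem_smul
      (range_le_jacobson hN (Finsupp.lapply y ∘ₗ s ∘ₗ a) ⟨n, rfl⟩) Submodule.mem_top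
  have key2 : ∀ m : ℕ, ∀ n, ((b ∘ₗ a : Module.End R N) ^ m) n ∈ J ^ m • (⊤ : Submodule R N) := by
    intro m
    induction m with
    | zero =>
      intro n
      rw [Submodule.pow_zero, pow_zero, Ideal.one_eq_top, Submodule.top_smul]
      exact Submodule.mem_top
    | succ m ih =>
      intro n
      have h1 : J • (⊤ : Submodule R N) ≤ (J ^ (m + 1) • (⊤ : Submodule R N)).comap
          ((b ∘ₗ a : Module.End R N) ^ m) := by
        rw [← Submodule.map_le_iff_le_comap, Submodule.map_smul'', Ideal.IsTwoSided.pow_succ, Submodule.mul_smul]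
        refine Submodule.smul_mono le_rfl ?_
        rintro _ ⟨x, -, rfl⟩
        exact ih x
      rw [pow_succ]
      exact h1 (key n)
  obtain ⟨m, hm⟩ := IsArtinianRing.isNilpotent_jacobson_bot (R := R)
  refine ⟨m, LinearMap.ext fun n => ?_⟩
  have := key2 m n
  rw [hJ, hm] at this
  simpa using this

/-- If `N` has no nonzero projective direct summand and is stably isomorphic to `K`, then `N` is a
direct summand of `K` with projective complement. -/
theorem exists_split_of_stably_equiv
    (hN : ∀ u : N →ₗ[R] N, u ∘ₗ u = u → Module.Projective R (LinearMap.range u) → u = 0)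
    {K X Y : Type*} [AddCommGroup K] [Module R K] [AddCommGroup X] [Module R X]
    [AddCommGroup Y] [Module R Y] [Module.Projective R X] [Module.Projective R Y]
    (e : (N × X) ≃ₗ[R] (K × Y)) :
    ∃ (i : N →ₗ[R] K) (g : K →ₗ[R] N), g ∘ₗ i = LinearMap.id ∧
      Module.Projective R (LinearMap.ker g) := by
  let i : N →ₗ[R] K := LinearMap.fst R K Y ∘ₗ e.toLinearMap ∘ₗ LinearMap.inl R N X
  let a : N →ₗ[R] Y := LinearMap.snd R K Y ∘ₗ e.toLinearMap ∘ₗ LinearMap.inl R N X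
  let g₀ : K →ₗ[R] N := LinearMap.fst R N X ∘ₗ e.symm.toLinearMap ∘ₗ LinearMap.inl R K Y
  let b : Y →ₗ[R] N := LinearMap.fst R N X ∘ₗ e.symm.toLinearMap ∘ₗ LinearMap.inr R K Y
  -- This is the `N`-component of `e⁻¹ ∘ e = 1`. As `b ∘ₗ a` factors through the projective `Y`, it
  -- is nilpotent and `g₀ ∘ₗ i` is invertible.
  have hgi : (g₀ ∘ₗ i : Module.End R N) = 1 - b ∘ₗ a := by
    rw [eq_sub_iff_add_eq]
    ext n
    change (e.symm ((e (n, 0)).1, 0)).1 + (e.symm (0, (e (n, 0)).2)).1 = n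
    rw [← Prod.fst_add, ← map_add]
    simp
  obtain ⟨u, hu⟩ := (isNilpotent_of_factors_projective hN a b).isUnit_one_sub
  let g : K →ₗ[R] N := ((u⁻¹ : (Module.End R N)ˣ) : Module.End R N) ∘ₗ g₀
  have hg : g ∘ₗ i = LinearMap.id := by
    change ((u⁻¹ : (Module.End R N)ˣ) : Module.End R N) * (g₀ ∘ₗ i) = 1
    rw [hgi, ← hu, Units.inv_mul]
  have hker : ∀ c, g c = 0 → g₀ c = 0 := fun c hc => by
    have : g₀ c = (u : Module.End R N) (((u⁻¹ : (Module.End R N)ˣ) : Module.End R N) (g₀ c)) := by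
      rw [← Module.End.mul_apply, Units.mul_inv, Module.End.one_apply]
    rw [this]
    change (u : Module.End R N) (g c) = 0
    rw [hc, map_zero]
  refine ⟨i, g, hg, ?_⟩
  -- The kernel is a retract of `X`: for `c` in it, `e⁻¹ (c, 0)` has no `N`-component, so its
  -- `X`-component determines `c`. The way back corrects by `1 - i ∘ₗ g` to land in the kernel.
  refine Module.Projective.of_split (P := LinearMap.ker g) (M := X)
    (LinearMap.snd R N X ∘ₗ e.symm.toLinearMap ∘ₗ LinearMap.inl R K Y ∘ₗ (LinearMap.ker g).subtype)
    (((LinearMap.id - i ∘ₗ g) ∘ₗ LinearMap.fst R K Y ∘ₗ e.toLinearMap ∘ₗ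
      LinearMap.inr R N X).codRestrict (LinearMap.ker g) fun x => ?_) ?_
  · have := LinearMap.congr_fun hg (g (e (0, x)).1)
    simp only [LinearMap.comp_apply, LinearMap.id_apply] at this
    simp [this]
  · ext ⟨c, hc⟩
    have h0 : (e.symm (c, 0)).1 = 0 := hker c hc
    have h1 : ((0 : N), (e.symm (c, 0)).2) = e.symm (c, 0) := Prod.ext h0.symm rfl
    change (e (0, (e.symm (c, 0)).2)).1 - i (g (e (0, (e.symm (c, 0)).2)).1) = c
    rw [h1, LinearEquiv.apply_symm_apply, LinearMap.mem_ker.1 hc, map_zero, sub_zero]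

end ArtinianRing

/-! ### Schanuel's lemma and its dual -/

section Schanuel

variable {R : Type*} [Ring R] {L L' P P' M : Type*} [AddCommGroup L] [Module R L]
  [AddCommGroup L'] [Module R L'] [AddCommGroup P] [Module R P] [AddCommGroup P'] [Module R P']
  [AddCommGroup M] [Module R M]

/-- Schanuel's lemma. -/
theorem schanuel {f : L →ₗ[R] P} {g : P →ₗ[R] M} {f' : L' →ₗ[R] P'} {g' : P' →ₗ[R] M}
    (hf : Function.Injective f) (hf' : Function.Injective f') (hfg : Function.Exact f g)
    (hfg' : Function.Exact f' g') (h : P' →ₗ[R] P) (h' : P →ₗ[R] P') (hh : g ∘ₗ h = g')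
    (hh' : g' ∘ₗ h' = g) : Nonempty ((L × P') ≃ₗ[R] (L' × P)) := by
  -- Both `u` and `u'` are injective with image the fibre product of `P` and `P'` over `M`. The
  -- comparison maps `h` and `h'` are all that projectivity would supply.
  let u : (L × P') →ₗ[R] (P × P') :=
    LinearMap.prod (f.coprod h) (LinearMap.snd R L P')
  let u' : (L' × P) →ₗ[R] (P × P') :=
    LinearMap.prod (LinearMap.snd R L' P) (f'.coprod h')
  have hh1 := fun x => LinearMap.congr_fun hh x
  have hh1' := fun x => LinearMap.congr_fun hh' x
  simp only [LinearMap.comp_apply] at hh1 hh1'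
  have hu : Function.Injective u := by
    rw [injective_iff_map_eq_zero]
    rintro ⟨x, p⟩ hx
    obtain ⟨h1, h2⟩ := Prod.ext_iff.1 hx
    change p = 0 at h2
    subst h2
    change f x + h 0 = 0 at h1
    rw [map_zero, add_zero, ← map_zero f] at h1
    rw [hf h1]; rfl
  have hu' : Function.Injective u' := by
    rw [injective_iff_map_eq_zero]
    rintro ⟨x, p⟩ hx
    obtain ⟨h1, h2⟩ := Prod.ext_iff.1 hx
    change p = 0 at h1
    subst h1
    change f' x + h' 0 = 0 at h2
    rw [map_zero, add_zero, ← map_zero f'] at h2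
    rw [hf' h2]; rfl
  have hr : ∀ z : P × P', z ∈ LinearMap.range u ↔ g z.1 = g' z.2 := by
    rintro ⟨p, p'⟩
    constructor
    · rintro ⟨⟨x, y⟩, hxy⟩
      obtain ⟨h1, h2⟩ := Prod.ext_iff.1 hxy
      change f x + h y = p at h1
      change y = p' at h2
      change g p = g' p'
      rw [← h1, ← h2, map_add, hh1, hfg.apply_apply_eq_zero, zero_add]
    · intro hz
      obtain ⟨x, hx⟩ := (hfg (p - h p')).1 (by rw [map_sub, hh1]; exact sub_eq_zero.2 hz)
      exact ⟨(x, p'), Prod.ext (show f x + h p' = p by rw [hx, sub_add_cancel]) rfl⟩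
  have hr' : ∀ z : P × P', z ∈ LinearMap.range u' ↔ g z.1 = g' z.2 := by
    rintro ⟨p, p'⟩
    constructor
    · rintro ⟨⟨x, y⟩, hxy⟩
      obtain ⟨h1, h2⟩ := Prod.ext_iff.1 hxy
      change y = p at h1
      change f' x + h' y = p' at h2
      change g p = g' p'
      rw [← h1, ← h2, map_add, hh1', hfg'.apply_apply_eq_zero, zero_add]
    · intro hz
      obtain ⟨x, hx⟩ := (hfg' (p' - h' p)).1 (by rw [map_sub, hh1']; exact sub_eq_zero.2 hz.symm)
      exact ⟨(x, p), Prod.ext rfl (show f' x + h' p = p' by rw [hx, sub_add_cancel])⟩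
  have hrr : LinearMap.range u = LinearMap.range u' := by
    ext z; rw [hr, hr']
  exact ⟨(LinearEquiv.ofInjective u hu).trans ((LinearEquiv.ofEq _ _ hrr).trans
    (LinearEquiv.ofInjective u' hu').symm)⟩

/-- The dual of Schanuel's lemma. -/
theorem schanuel_dual {f : M →ₗ[R] P} {g : P →ₗ[R] L} {f' : M →ₗ[R] P'} {g' : P' →ₗ[R] L'}
    (hg : Function.Surjective g) (hg' : Function.Surjective g') (hfg : Function.Exact f g)
    (hfg' : Function.Exact f' g') (h : P →ₗ[R] P') (h' : P' →ₗ[R] P) (hh : h ∘ₗ f = f')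
    (hh' : h' ∘ₗ f' = f) : Nonempty ((L × P') ≃ₗ[R] (L' × P)) := by
  -- Both `u` and `u'` are surjective with kernel `{(f m, f' m)}`, so both targets are the pushout
  -- of `P` and `P'` under `M`.
  let u : (P × P') →ₗ[R] (L × P') :=
    LinearMap.prod (g ∘ₗ LinearMap.fst R P P') (LinearMap.snd R P P' - h ∘ₗ LinearMap.fst R P P')
  let u' : (P × P') →ₗ[R] (L' × P) :=
    LinearMap.prod (g' ∘ₗ LinearMap.snd R P P') (LinearMap.fst R P P' - h' ∘ₗ LinearMap.snd R P P')
  have hh1 := fun x => LinearMap.congr_fun hh x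
  have hh1' := fun x => LinearMap.congr_fun hh' x
  simp only [LinearMap.comp_apply] at hh1 hh1'
  have hu : Function.Surjective u := by
    rintro ⟨x, p'⟩
    obtain ⟨p, rfl⟩ := hg x
    exact ⟨(p, p' + h p), Prod.ext rfl (show p' + h p - h p = p' from add_sub_cancel_right _ _)⟩
  have hu' : Function.Surjective u' := by
    rintro ⟨x, p⟩
    obtain ⟨p', rfl⟩ := hg' x
    exact ⟨(p + h' p', p'), Prod.ext rfl (show p + h' p' - h' p' = p from add_sub_cancel_right _ _)⟩
  have hk : ∀ z : P × P', z ∈ LinearMap.ker u ↔ ∃ m, z = (f m, f' m) := by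
    rintro ⟨p, p'⟩
    constructor
    · intro hz
      obtain ⟨h1, h2⟩ := Prod.ext_iff.1 (LinearMap.mem_ker.1 hz)
      obtain ⟨m, rfl⟩ := (hfg p).1 h1
      exact ⟨m, Prod.ext rfl ((sub_eq_zero.1 h2).trans (hh1 m))⟩
    · rintro ⟨m, hm⟩
      rw [hm]
      exact Prod.ext (hfg.apply_apply_eq_zero m) (sub_eq_zero.2 (hh1 m).symm)
  have hk' : ∀ z : P × P', z ∈ LinearMap.ker u' ↔ ∃ m, z = (f m, f' m) := by
    rintro ⟨p, p'⟩
    constructor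
    · intro hz
      obtain ⟨h1, h2⟩ := Prod.ext_iff.1 (LinearMap.mem_ker.1 hz)
      obtain ⟨m, rfl⟩ := (hfg' p').1 h1
      exact ⟨m, Prod.ext ((sub_eq_zero.1 h2).trans (hh1' m)) rfl⟩
    · rintro ⟨m, hm⟩
      rw [hm]
      exact Prod.ext (hfg'.apply_apply_eq_zero m) (sub_eq_zero.2 (hh1' m).symm)
  have hkk : LinearMap.ker u = LinearMap.ker u' := by
    ext z; rw [hk, hk']
  exact ⟨(u.quotKerEquivOfSurjective hu).symm.trans
    ((Submodule.quotEquivOfEq _ _ hkk).trans (u'.quotKerEquivOfSurjective hu'))⟩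

end Schanuel

namespace RatMod

/-! ### Homomorphisms, direct sums, kernels and cokernels of rational modules -/

section Basic

variable {k A : Type u} [Field k] [CommRing A] [HopfAlgebra k A]

theorem IsHom.apply {V W : RatMod k A} {f : V.carrier →ₗ[k] W.carrier} (hf : IsHom V W f)
    (v : V.carrier) : W.coact (f v) = f.rTensor A (V.coact v) :=
  LinearMap.congr_fun hf v

theorem IsHom.id (V : RatMod k A) : IsHom V V LinearMap.id := by
  rw [IsHom, LinearMap.rTensor_id]; rfl

theorem IsHom.comp {U V W : RatMod k A} {g : V.carrier →ₗ[k] W.carrier}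
    {f : U.carrier →ₗ[k] V.carrier} (hg : IsHom V W g) (hf : IsHom U V f) :
    IsHom U W (g ∘ₗ f) := by
  rw [IsHom, ← LinearMap.comp_assoc, hg, LinearMap.comp_assoc, hf, LinearMap.rTensor_comp,
    LinearMap.comp_assoc]

theorem IsHom.symm {V W : RatMod k A} {e : V.carrier ≃ₗ[k] W.carrier}
    (he : IsHom V W e.toLinearMap) : IsHom W V e.symm.toLinearMap := by
  have h1 : (e.symm.toLinearMap).rTensor A ∘ₗ (e.toLinearMap).rTensor A = LinearMap.id := by
    rw [← LinearMap.rTensor_comp, LinearEquiv.symm_comp, LinearMap.rTensor_id]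
  calc V.coact ∘ₗ e.symm.toLinearMap
      = ((e.symm.toLinearMap).rTensor A ∘ₗ (e.toLinearMap).rTensor A) ∘ₗ V.coact ∘ₗ
          e.symm.toLinearMap := by rw [h1]; rfl
    _ = (e.symm.toLinearMap).rTensor A ∘ₗ (W.coact ∘ₗ e.toLinearMap) ∘ₗ e.symm.toLinearMap := by
        rw [he]; rfl
    _ = (e.symm.toLinearMap).rTensor A ∘ₗ W.coact := by
        rw [LinearMap.comp_assoc, LinearEquiv.comp_symm]; rfl

theorem Iso.refl (V : RatMod k A) : Iso V V := ⟨LinearEquiv.refl k _, IsHom.id V⟩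

theorem Iso.trans {U V W : RatMod k A} : Iso U V → Iso V W → Iso U W :=
  fun ⟨e, he⟩ ⟨e', he'⟩ => ⟨e.trans e', he'.comp he⟩

/-- The first inclusion into a direct sum. -/
def inl (V W : RatMod k A) : V.carrier →ₗ[k] (directSum V W).carrier :=
  LinearMap.inl k V.carrier W.carrier

/-- The second inclusion into a direct sum. -/
def inr (V W : RatMod k A) : W.carrier →ₗ[k] (directSum V W).carrier :=
  LinearMap.inr k V.carrier W.carrier

/-- The first projection from a direct sum. -/
def fst (V W : RatMod k A) : (directSum V W).carrier →ₗ[k] V.carrier :=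
  LinearMap.fst k V.carrier W.carrier

/-- The second projection from a direct sum. -/
def snd (V W : RatMod k A) : (directSum V W).carrier →ₗ[k] W.carrier :=
  LinearMap.snd k V.carrier W.carrier

theorem isHom_inl (V W : RatMod k A) : IsHom V (directSum V W) (inl V W) :=
  LinearMap.coprod_inl _ _

theorem isHom_inr (V W : RatMod k A) : IsHom W (directSum V W) (inr V W) :=
  LinearMap.coprod_inr _ _

theorem isHom_prod_ext {V W U : RatMod k A} {f : (directSum V W).carrier →ₗ[k] U.carrier}
    (h1 : IsHom V U (f ∘ₗ inl V W)) (h2 : IsHom W U (f ∘ₗ inr V W)) :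
    IsHom (directSum V W) U f := by
  have key : ∀ {X : RatMod k A} (i : X.carrier →ₗ[k] (directSum V W).carrier),
      IsHom X (directSum V W) i → IsHom X U (f ∘ₗ i) →
        (U.coact ∘ₗ f) ∘ₗ i = (f.rTensor A ∘ₗ (directSum V W).coact) ∘ₗ i := by
    intro X i hi hfi
    rw [LinearMap.comp_assoc, hfi, LinearMap.rTensor_comp, LinearMap.comp_assoc,
      LinearMap.comp_assoc, hi]
  exact LinearMap.prod_ext (key _ (isHom_inl V W) h1) (key _ (isHom_inr V W) h2)

theorem isHom_zero (V W : RatMod k A) : IsHom V W 0 := by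
  rw [IsHom, LinearMap.comp_zero, LinearMap.rTensor_zero, LinearMap.zero_comp]

theorem isHom_fst (V W : RatMod k A) : IsHom (directSum V W) V (fst V W) :=
  isHom_prod_ext (IsHom.id V) (isHom_zero W V)

theorem isHom_snd (V W : RatMod k A) : IsHom (directSum V W) W (snd V W) :=
  isHom_prod_ext (isHom_zero V W) (IsHom.id W)

/-- Both sides of the coassociativity law are natural. -/
theorem rTensor_comp_coassoc {V W : Type u} [AddCommGroup V] [Module k V] [AddCommGroup W]
    [Module k W] (ρ : V →ₗ[k] V ⊗[k] A) (ρ' : W →ₗ[k] W ⊗[k] A) (f : V →ₗ[k] W)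
    (h : ρ' ∘ₗ f = f.rTensor A ∘ₗ ρ) :
    f.rTensor (A ⊗[k] A) ∘ₗ (TensorProduct.assoc k V A A).toLinearMap ∘ₗ ρ.rTensor A ∘ₗ ρ =
      ((TensorProduct.assoc k W A A).toLinearMap ∘ₗ ρ'.rTensor A ∘ₗ ρ') ∘ₗ f := by
  have h1 : ρ'.rTensor A ∘ₗ f.rTensor A = (f.rTensor A).rTensor A ∘ₗ ρ.rTensor A := by
    rw [← LinearMap.rTensor_comp, h, LinearMap.rTensor_comp]
  simp only [LinearMap.comp_assoc, h]
  rw [← LinearMap.comp_assoc ρ (f.rTensor A), h1, ← LinearMap.comp_assoc, ← assoc_rTensor]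
  simp only [LinearMap.comp_assoc]

/-- A linear subspace that is stable under the coaction is a rational module. -/
noncomputable def sub (V : RatMod k A) (K : Submodule k V.carrier) (q : V.carrier →ₗ[k] K)
    (hq : q ∘ₗ K.subtype = LinearMap.id)
    (h : (K.subtype ∘ₗ q).rTensor A ∘ₗ V.coact ∘ₗ K.subtype = V.coact ∘ₗ K.subtype) :
    RatMod k A where
  carrier := K
  coact := q.rTensor A ∘ₗ V.coact ∘ₗ K.subtype
  coassoc := by
    set ρ := q.rTensor A ∘ₗ V.coact ∘ₗ K.subtype with hρ
    have h1 : V.coact ∘ₗ K.subtype = K.subtype.rTensor A ∘ₗ ρ := by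
      rw [hρ, ← LinearMap.comp_assoc, ← LinearMap.rTensor_comp, h]
    have h2 := rTensor_comp_coassoc ρ V.coact K.subtype h1
    rw [V.coassoc, LinearMap.comp_assoc, h1, ← LinearMap.comp_assoc _ _ (LinearMap.lTensor _ _),
      LinearMap.lTensor_comp_rTensor, ← LinearMap.rTensor_comp_lTensor, LinearMap.comp_assoc] at h2
    have h3 : q.rTensor (A ⊗[k] A) ∘ₗ K.subtype.rTensor (A ⊗[k] A) = LinearMap.id := by
      rw [← LinearMap.rTensor_comp, hq, LinearMap.rTensor_id]
    have h4 := congrArg (fun z => q.rTensor (A ⊗[k] A) ∘ₗ z) h2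
    simpa only [← LinearMap.comp_assoc, h3, LinearMap.id_comp] using h4
  counit_coact := by
    rw [← LinearMap.comp_assoc, LinearMap.lTensor_comp_rTensor, ← LinearMap.rTensor_comp_lTensor,
      LinearMap.comp_assoc, ← LinearMap.comp_assoc K.subtype, V.counit_coact]
    ext v
    have : q (v : V.carrier) = v := LinearMap.congr_fun hq v
    simp [this]

theorem isHom_sub_subtype (V : RatMod k A) (K : Submodule k V.carrier) (q : V.carrier →ₗ[k] K)
    (hq : q ∘ₗ K.subtype = LinearMap.id)
    (h : (K.subtype ∘ₗ q).rTensor A ∘ₗ V.coact ∘ₗ K.subtype = V.coact ∘ₗ K.subtype) :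
    IsHom (sub V K q hq h) V K.subtype := by
  change V.coact ∘ₗ K.subtype = K.subtype.rTensor A ∘ₗ q.rTensor A ∘ₗ V.coact ∘ₗ K.subtype
  rw [← LinearMap.comp_assoc, ← LinearMap.rTensor_comp, h]

/-- Over a field every linear map has a generalized inverse. -/
theorem exists_generalized_inverse {V W : Type*} [AddCommGroup V] [Module k V] [AddCommGroup W]
    [Module k W] (f : V →ₗ[k] W) : ∃ r : W →ₗ[k] V, f ∘ₗ r ∘ₗ f = f := by
  obtain ⟨s, hs⟩ := f.rangeRestrict.exists_rightInverse_of_surjective f.range_rangeRestrict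
  obtain ⟨r, hr⟩ := LinearMap.exists_extend s
  refine ⟨r, ?_⟩
  ext v
  have h1 : r (f v) = s (f.rangeRestrict v) := LinearMap.congr_fun hr (f.rangeRestrict v)
  rw [LinearMap.comp_apply, LinearMap.comp_apply, h1]
  exact congrArg Subtype.val (LinearMap.congr_fun hs (f.rangeRestrict v))

/-- Kernels exist. -/
theorem exists_kernel {V W : RatMod k A} {f : V.carrier →ₗ[k] W.carrier} (hf : IsHom V W f) :
    ∃ (K : RatMod k A) (i : K.carrier →ₗ[k] V.carrier), IsHom K V i ∧ Function.Injective i ∧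
      Function.Exact i f := by
  obtain ⟨r, hr⟩ := exists_generalized_inverse f
  have hr' : ∀ v, f (r (f v)) = f v := LinearMap.congr_fun hr
  -- The projection `1 - r ∘ₗ f` differs from the identity by a map through `f`. As `f` commutes
  -- with the coactions, that term vanishes on the coaction of a kernel element, which gives
  -- stability.
  let q : V.carrier →ₗ[k] LinearMap.ker f :=
    (LinearMap.id - r ∘ₗ f).codRestrict (LinearMap.ker f) fun v => by simp [hr']
  have hq : q ∘ₗ (LinearMap.ker f).subtype = LinearMap.id := by
    ext ⟨v, hv⟩
    rw [LinearMap.mem_ker] at hv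
    simp [q, hv]
  have h1 : (LinearMap.ker f).subtype ∘ₗ q = LinearMap.id - r ∘ₗ f := by ext v; rfl
  have h2 : f ∘ₗ (LinearMap.ker f).subtype = 0 := by ext ⟨v, hv⟩; exact hv
  have h : ((LinearMap.ker f).subtype ∘ₗ q).rTensor A ∘ₗ V.coact ∘ₗ (LinearMap.ker f).subtype =
      V.coact ∘ₗ (LinearMap.ker f).subtype := by
    rw [h1, LinearMap.rTensor_sub, LinearMap.rTensor_id, LinearMap.sub_comp, LinearMap.id_comp,
      LinearMap.rTensor_comp, LinearMap.comp_assoc, ← LinearMap.comp_assoc _ _ (f.rTensor A), ← hf,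
      LinearMap.comp_assoc, h2, LinearMap.comp_zero, LinearMap.comp_zero, sub_zero]
  refine ⟨sub V _ q hq h, _, isHom_sub_subtype V _ q hq h, Subtype.val_injective, fun v => ?_⟩
  exact ⟨fun hv => ⟨⟨v, hv⟩, rfl⟩, fun ⟨x, hx⟩ => by rw [← hx]; exact x.2⟩

/-- Cokernels exist. -/
theorem exists_cokernel {V W : RatMod k A} {f : V.carrier →ₗ[k] W.carrier} (hf : IsHom V W f) :
    ∃ (C : RatMod k A) (p : W.carrier →ₗ[k] C.carrier), IsHom W C p ∧ Function.Surjective p ∧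
      Function.Exact f p := by
  let p := (LinearMap.range f).mkQ
  have hp : p ∘ₗ f = 0 := LinearMap.range_mkQ_comp f
  let ρ : (W.carrier ⧸ LinearMap.range f) →ₗ[k] (W.carrier ⧸ LinearMap.range f) ⊗[k] A :=
    (LinearMap.range f).liftQ (p.rTensor A ∘ₗ W.coact) (by
      rw [LinearMap.range_le_ker_iff, LinearMap.comp_assoc, hf, ← LinearMap.comp_assoc,
        ← LinearMap.rTensor_comp, hp, LinearMap.rTensor_zero, LinearMap.zero_comp])
  have hρ : ρ ∘ₗ p = p.rTensor A ∘ₗ W.coact := Submodule.liftQ_mkQ _ _ _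
  have hs : Function.Surjective p := Submodule.mkQ_surjective _
  refine ⟨⟨W.carrier ⧸ LinearMap.range f, ρ, ?_, ?_⟩, p, hρ, hs, ?_⟩
  · exact (LinearMap.cancel_right hs).1 (coassoc_comp W ρ p hρ)
  · exact (LinearMap.cancel_right hs).1 (counit_comp W ρ p hρ)
  · intro w
    exact (Submodule.Quotient.mk_eq_zero _).trans Iff.rfl

end Basic

/-! ### Rational modules as modules over the dual algebra -/

section Dual

variable {k A : Type u} [Field k] [CommRing A] [HopfAlgebra k A]

/-- Contraction with a linear form on the second factor. -/
noncomputable def contract (V : Type u) [AddCommGroup V] [Module k V] (r : A →ₗ[k] k) :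
    V ⊗[k] A →ₗ[k] V :=
  (TensorProduct.rid k V).toLinearMap ∘ₗ r.lTensor V

@[simp]
theorem contract_tmul {V : Type u} [AddCommGroup V] [Module k V] (r : A →ₗ[k] k) (v : V) (a : A) :
    contract V r (v ⊗ₜ a) = r a • v := by
  simp [contract]

theorem contract_rTensor {V W : Type u} [AddCommGroup V] [Module k V] [AddCommGroup W] [Module k W]
    (r : A →ₗ[k] k) (f : V →ₗ[k] W) (t : V ⊗[k] A) :
    contract W r (f.rTensor A t) = f (contract V r t) := by
  induction t using TensorProduct.induction_on with
  | zero => simp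
  | tmul v a => simp
  | add x y hx hy => simp only [map_add, hx, hy]

/-- Coassociativity tested on `r ⊗ s`; it supplies the law `mul_smul`, and right comodules become
left modules without reversing products. -/
theorem contract_coact_contract (V : RatMod k A) (r s : A →ₗ[k] k) (v : V.carrier) :
    contract V.carrier r (V.coact (contract V.carrier s (V.coact v))) =
      contract V.carrier (WithConv.toConv r * WithConv.toConv s).ofConv (V.coact v) := by
  let D : V.carrier ⊗[k] (A ⊗[k] A) →ₗ[k] V.carrier :=
    (TensorProduct.rid k V.carrier).toLinearMap ∘ₗ
      (LinearMap.mul' k k ∘ₗ TensorProduct.map r s).lTensor V.carrier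
  have h1 : ∀ t : V.carrier ⊗[k] A, contract V.carrier r (V.coact (contract V.carrier s t)) =
      D (TensorProduct.assoc k _ _ _ (V.coact.rTensor A t)) := by
    intro t
    induction t using TensorProduct.induction_on with
    | zero => simp
    | add x y hx hy => simp only [map_add, hx, hy]
    | tmul v a =>
      rw [contract_tmul, map_smul, map_smul, LinearMap.rTensor_tmul]
      induction V.coact v using TensorProduct.induction_on with
      | zero => simp
      | add x y hx hy => simp only [map_add, smul_add, TensorProduct.add_tmul, hx, hy]
      | tmul w b =>
        rw [contract_tmul, smul_smul, mul_comm]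
        simp [D]
  have h2 : ∀ t : V.carrier ⊗[k] A, D ((Coalgebra.comul (R := k) (A := A)).lTensor V.carrier t) =
      contract V.carrier (WithConv.toConv r * WithConv.toConv s).ofConv t := by
    intro t
    induction t using TensorProduct.induction_on with
    | zero => simp
    | add x y hx hy => simp only [map_add, hx, hy]
    | tmul v a => simp [D]
  rw [h1, ← h2]
  exact congrArg D (LinearMap.congr_fun V.coassoc v)

/-- A rational module is a module over the convolution algebra of linear forms. -/
noncomputable instance dualModule (V : RatMod k A) :
    Module (WithConv (A →ₗ[k] k)) V.carrier where
  smul r v := contract V.carrier r.ofConv (V.coact v)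
  one_smul v := by
    have h1 : ∀ t : V.carrier ⊗[k] A, contract V.carrier
        (1 : WithConv (A →ₗ[k] k)).ofConv t =
        TensorProduct.rid k _ ((Coalgebra.counit (R := k) (A := A)).lTensor V.carrier t) := by
      intro t
      induction t using TensorProduct.induction_on with
      | zero => simp
      | add x y hx hy => simp only [map_add, hx, hy]
      | tmul v a => simp
    refine (h1 _).trans ?_
    have := LinearMap.congr_fun V.counit_coact v
    simp only [LinearMap.comp_apply] at this
    rw [this]
    simp
  mul_smul r s v := (contract_coact_contract V r.ofConv s.ofConv v).symm
  smul_zero r := by change contract _ _ _ = 0; simp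
  smul_add r v w := by
    change contract _ _ _ = contract _ _ _ + contract _ _ _; simp
  add_smul r s v := by
    change contract _ _ _ = contract _ _ _ + contract _ _ _
    rw [WithConv.ofConv_add, contract, LinearMap.lTensor_add, LinearMap.comp_add]; rfl
  zero_smul v := by
    change contract _ _ _ = 0
    rw [WithConv.ofConv_zero, contract, LinearMap.lTensor_zero]; rfl

theorem dual_smul_def (V : RatMod k A) (r : WithConv (A →ₗ[k] k)) (v : V.carrier) :
    r • v = contract V.carrier r.ofConv (V.coact v) := rfl

instance (V : RatMod k A) : IsScalarTower k (WithConv (A →ₗ[k] k)) V.carrier where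
  smul_assoc c r v := by
    rw [dual_smul_def, dual_smul_def, WithConv.ofConv_smul, contract, LinearMap.lTensor_smul,
      LinearMap.comp_smul]; rfl

theorem IsHom.map_smul {V W : RatMod k A} {f : V.carrier →ₗ[k] W.carrier} (hf : IsHom V W f)
    (r : WithConv (A →ₗ[k] k)) (v : V.carrier) : f (r • v) = r • f v := by
  rw [dual_smul_def, dual_smul_def, hf.apply, contract_rTensor]

/-- A homomorphism of rational modules, as a linear map over the dual algebra. -/
noncomputable def IsHom.toDual {V W : RatMod k A} {f : V.carrier →ₗ[k] W.carrier}
    (hf : IsHom V W f) : V.carrier →ₗ[WithConv (A →ₗ[k] k)] W.carrier where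
  toFun := f
  map_add' := f.map_add
  map_smul' := hf.map_smul

@[simp]
theorem IsHom.toDual_apply {V W : RatMod k A} {f : V.carrier →ₗ[k] W.carrier}
    (hf : IsHom V W f) (v : V.carrier) : hf.toDual v = f v := rfl

theorem sum_contract_tmul {ι : Type*} [Fintype ι] (b : Module.Basis ι k A) {V : Type u}
    [AddCommGroup V] [Module k V] (t : V ⊗[k] A) :
    ∑ i, contract V (b.coord i) t ⊗ₜ b i = t := by
  induction t using TensorProduct.induction_on with
  | zero => simp
  | add x y hx hy => simp only [map_add, TensorProduct.add_tmul, Finset.sum_add_distrib, hx, hy]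
  | tmul v a =>
    simp only [contract_tmul, TensorProduct.smul_tmul, ← TensorProduct.tmul_sum,
      Module.Basis.coord_apply, b.sum_repr]

theorem eq_of_contract_eq [Module.Finite k A] {V : Type u} [AddCommGroup V] [Module k V]
    {x y : V ⊗[k] A} (h : ∀ r : A →ₗ[k] k, contract V r x = contract V r y) : x = y := by
  rw [← sum_contract_tmul (Module.finBasis k A) x, ← sum_contract_tmul (Module.finBasis k A) y]
  simp only [h]

/-- When `A` is finite-dimensional its linear forms separate the elements of `V ⊗ A`. Comodule maps
and linear maps over the dual algebra are then the same, so ordinary module theory applies. -/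
theorem isHom_restrictScalars [Module.Finite k A] {V W : RatMod k A}
    (f : V.carrier →ₗ[WithConv (A →ₗ[k] k)] W.carrier) : IsHom V W (f.restrictScalars k) := by
  refine LinearMap.ext fun v => eq_of_contract_eq fun r => ?_
  rw [LinearMap.comp_apply, LinearMap.comp_apply, contract_rTensor]
  exact (f.map_smul (WithConv.toConv r) v).symm

theorem Iso.nonempty_linearEquiv {V W : RatMod k A} : Iso V W →
    Nonempty (V.carrier ≃ₗ[WithConv (A →ₗ[k] k)] W.carrier) :=
  fun ⟨e, he⟩ => ⟨{ he.toDual with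
    invFun := e.symm
    left_inv := e.symm_apply_apply
    right_inv := e.apply_symm_apply }⟩

theorem iso_of_linearEquiv [Module.Finite k A] {V W : RatMod k A}
    (e : V.carrier ≃ₗ[WithConv (A →ₗ[k] k)] W.carrier) : Iso V W :=
  ⟨e.restrictScalars k, isHom_restrictScalars e.toLinearMap⟩

/-- The direct sum of rational modules is the product of modules over the dual algebra. -/
noncomputable def directSumEquiv (V W : RatMod k A) :
    (directSum V W).carrier ≃ₗ[WithConv (A →ₗ[k] k)] V.carrier × W.carrier where
  __ := LinearMap.prod (isHom_fst V W).toDual (isHom_snd V W).toDual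
  invFun := id
  left_inv _ := rfl
  right_inv _ := rfl

end Dual

/-! ### The group law on points -/

section Points

variable {k A T : Type u} [Field k] [CommRing A] [HopfAlgebra k A] [CommRing T] [Algebra k T]

/-- The comultiplication is the product of the two universal points. -/
theorem toConv_comulAlgHom : WithConv.toConv (Bialgebra.comulAlgHom k A) =
    WithConv.toConv (Algebra.TensorProduct.includeLeft : A →ₐ[k] A ⊗[k] A) *
      WithConv.toConv (Algebra.TensorProduct.includeRight : A →ₐ[k] A ⊗[k] A) := by
  rw [AlgHom.convMul_def]
  congr 1
  rw [← AlgHom.comp_assoc]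
  have : (Algebra.TensorProduct.lmul' k).comp (Algebra.TensorProduct.map
      (Algebra.TensorProduct.includeLeft : A →ₐ[k] A ⊗[k] A)
      (Algebra.TensorProduct.includeRight : A →ₐ[k] A ⊗[k] A)) = AlgHom.id k _ := by
    ext <;> simp
  exact (congrArg (fun z => z.comp (Bialgebra.comulAlgHom k A)) this).symm

/-- Specialization of points is a group homomorphism. -/
theorem toConv_comp_mul {T' : Type u} [CommRing T'] [Algebra k T'] (φ : T →ₐ[k] T')
    (g h : WithConv (A →ₐ[k] T)) : WithConv.toConv (φ.comp (g * h).ofConv) =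
      WithConv.toConv (φ.comp g.ofConv) * WithConv.toConv (φ.comp h.ofConv) := by
  rw [AlgHom.comp_convMul_distrib]

end Points

section Inverse

variable {k A T T' : Type u} [Field k] [CommRing A] [HopfAlgebra k A] [CommRing T] [Bialgebra k T]
  [CommRing T'] [Bialgebra k T']

theorem toConv_comp_inv (φ : T →ₐ[k] T')
    (g : WithConv (A →ₐ[k] T)) : WithConv.toConv (φ.comp (g⁻¹).ofConv) =
      (WithConv.toConv (φ.comp g.ofConv))⁻¹ := rfl

theorem inv_apply (g : WithConv (A →ₐ[k] T)) (a : A) :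
    (g⁻¹).ofConv a = g.ofConv (HopfAlgebra.antipode k a) := rfl

end Inverse

/-! ### Integrals, and freeness of the regular module over the dual algebra -/

section Frobenius

variable (k A : Type u) [Field k] [CommRing A] [HopfAlgebra k A]

local notation "ι₁" =>
  WithConv.toConv (Algebra.TensorProduct.includeLeft : A →ₐ[k] A ⊗[k] A)
local notation "ι₂" =>
  WithConv.toConv (Algebra.TensorProduct.includeRight : A →ₐ[k] A ⊗[k] A)

/-- Translation by the universal point on `A ⊗ A`, considered as an `A`-algebra. -/
noncomputable def translate (g : A →ₐ[k] A ⊗[k] A) : A ⊗[k] A →ₐ[A] A ⊗[k] A :=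
  Algebra.TensorProduct.lift (Algebra.ofId A (A ⊗[k] A)) g fun _ _ => Commute.all _ _

theorem translate_comp (g h : A →ₐ[k] A ⊗[k] A)
    (H : ((translate k A g).restrictScalars k).comp h = Algebra.TensorProduct.includeRight) :
    (translate k A g).comp (translate k A h) = AlgHom.id A _ := by
  apply Algebra.TensorProduct.ext
  · ext
  · ext a
    have h1 := AlgHom.congr_fun H a
    have h2 : translate k A h (1 ⊗ₜ a) = h a := by simp [translate, ← Algebra.TensorProduct.one_def]
    change translate k A g (translate k A h (1 ⊗ₜ a)) = 1 ⊗ₜ a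
    rw [h2]
    exact h1

theorem translate_includeLeft (g : A →ₐ[k] A ⊗[k] A) :
    ((translate k A g).restrictScalars k).comp Algebra.TensorProduct.includeLeft =
      (Algebra.TensorProduct.includeLeft : A →ₐ[k] A ⊗[k] A) := by
  ext a
  simp [translate, Algebra.ofId_apply]

theorem translate_includeRight (g : A →ₐ[k] A ⊗[k] A) :
    ((translate k A g).restrictScalars k).comp Algebra.TensorProduct.includeRight = g := by
  ext a
  simp [translate]

/-- On points the two factors are `(x, y) ↦ (x, xy)` and `(x, y) ↦ (x, x⁻¹y)`, so the group law
makes them inverse to each other. -/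
theorem translate_comul_comp :
    (translate k A (Bialgebra.comulAlgHom k A)).comp (translate k A (ι₁⁻¹ * ι₂).ofConv) =
      AlgHom.id A _ := by
  apply translate_comp
  apply WithConv.toConv_injective
  rw [toConv_comp_mul, toConv_comp_inv, WithConv.ofConv_toConv, WithConv.ofConv_toConv,
    translate_includeLeft, translate_includeRight, toConv_comulAlgHom]
  exact inv_mul_cancel_left ι₁ ι₂

theorem translate_comp_comul :
    (translate k A (ι₁⁻¹ * ι₂).ofConv).comp (translate k A (Bialgebra.comulAlgHom k A)) =
      AlgHom.id A _ := by
  apply translate_comp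
  apply WithConv.toConv_injective
  have : Bialgebra.comulAlgHom k A = (ι₁ * ι₂).ofConv :=
    congrArg WithConv.ofConv toConv_comulAlgHom
  rw [this, toConv_comp_mul, WithConv.ofConv_toConv, WithConv.ofConv_toConv,
    translate_includeLeft, translate_includeRight]
  exact mul_inv_cancel_left ι₁ ι₂

variable {k A}

/-- The regular module `k[G]`. -/
noncomputable def regular (k A : Type u) [Field k] [CommRing A] [HopfAlgebra k A] :
    RatMod k A where
  carrier := A
  coact := Coalgebra.comul
  coassoc := Coalgebra.coassoc
  counit_coact := by
    rw [Coalgebra.lTensor_counit_comp_comul]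
    ext a
    simp

/-- Left translation of functions by a linear form. -/
noncomputable def leftShift (f : A →ₗ[k] k) : A →ₗ[k] A :=
  contract A f ∘ₗ Coalgebra.comul

/-- Coassociativity says that translations on the two sides commute. This lets the shift pass
through translation by the universal point in `contract_traceForm_comul`. -/
theorem comul_leftShift (f : A →ₗ[k] k) (a : A) :
    Coalgebra.comul (R := k) (leftShift f a) = (leftShift f).lTensor A (Coalgebra.comul a) := by
  have h1 : ∀ t : A ⊗[k] A, Coalgebra.comul (R := k) (contract A f t) =
      (contract A f).lTensor A (TensorProduct.assoc k A A A
        ((Coalgebra.comul (R := k) (A := A)).rTensor A t)) := by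
    intro t
    induction t using TensorProduct.induction_on with
    | zero => simp
    | add x y hx hy => simp only [map_add, hx, hy]
    | tmul v a =>
      rw [contract_tmul, map_smul, LinearMap.rTensor_tmul]
      induction Coalgebra.comul (R := k) v using TensorProduct.induction_on with
      | zero => simp
      | add x y hx hy => simp only [map_add, smul_add, TensorProduct.add_tmul, hx, hy]
      | tmul w b => simp
  rw [leftShift, LinearMap.comp_apply, h1, Coalgebra.coassoc_apply, LinearMap.lTensor_comp,
    LinearMap.comp_apply]

/-- The trace of translation followed by multiplication. -/
noncomputable def traceForm (f : A →ₗ[k] k) : A →ₗ[k] k :=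
  LinearMap.trace k A ∘ₗ LinearMap.mulLeft k (leftShift f : Module.End k A) ∘ₗ LinearMap.mul k A

theorem traceForm_apply (f : A →ₗ[k] k) (x : A) :
    traceForm f x = LinearMap.trace k A (leftShift f ∘ₗ LinearMap.mulLeft k x) := rfl

theorem trace_baseChange_leftShift [Module.Finite k A] (f : A →ₗ[k] k) (y : A ⊗[k] A) :
    LinearMap.trace A (A ⊗[k] A) ((leftShift f).baseChange A ∘ₗ LinearMap.mulLeft A y) =
      contract A (traceForm f) y := by
  induction y using TensorProduct.induction_on with
  | zero => simp
  | add x y hx hy =>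
    rw [map_add, ← hx, ← hy, ← map_add, ← LinearMap.comp_add]
    congr 2
    ext
    simp [add_mul]
  | tmul c b =>
    have : (leftShift f).baseChange A ∘ₗ LinearMap.mulLeft A (c ⊗ₜ[k] b) =
        c • (leftShift f ∘ₗ LinearMap.mulLeft k b).baseChange A := by
      ext x
      simp [TensorProduct.smul_tmul']
    rw [this, map_smul, LinearMap.trace_baseChange, contract_tmul, traceForm_apply,
      smul_eq_mul, mul_comm, ← Algebra.smul_def]

/-- The trace form is an integral. -/
theorem contract_traceForm_comul [Module.Finite k A] (f : A →ₗ[k] k) (x : A) :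
    contract A (traceForm f) (Coalgebra.comul x) = traceForm f x • (1 : A) := by
  set α := translate k A (Bialgebra.comulAlgHom k A) with hα
  set β := translate k A (ι₁⁻¹ * ι₂).ofConv with hβ
  have hαβ : ∀ z, α (β z) = z := AlgHom.congr_fun (translate_comul_comp k A)
  have hβα : β.toLinearMap ∘ₗ α.toLinearMap = LinearMap.id :=
    LinearMap.ext (AlgHom.congr_fun (translate_comp_comul k A))
  have hx : Coalgebra.comul (R := k) x = α (1 ⊗ₜ x) := by simp [hα, translate, ← Algebra.TensorProduct.one_def]
  -- Conjugation by `α` turns multiplication by `1 ⊗ x` into multiplication by the comultiplication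
  -- of `x`, and `α` commutes with the shift. The two `A`-linear traces therefore agree, which is
  -- the integral property.
  have hm : LinearMap.mulLeft A (α (1 ⊗ₜ x)) =
      α.toLinearMap ∘ₗ LinearMap.mulLeft A (1 ⊗ₜ x) ∘ₗ β.toLinearMap := by
    refine LinearMap.ext fun z => ?_
    change α (1 ⊗ₜ x) * z = α ((1 ⊗ₜ x) * β z)
    rw [map_mul, hαβ]
  have hL : (leftShift f).baseChange A ∘ₗ α.toLinearMap =
      α.toLinearMap ∘ₗ (leftShift f).baseChange A := by
    ext b
    have h1 : α (1 ⊗ₜ b) = Coalgebra.comul (R := k) b := by simp [hα, translate, ← Algebra.TensorProduct.one_def]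
    have h2 : α (1 ⊗ₜ leftShift f b) = Coalgebra.comul (R := k) (leftShift f b) := by
      simp [hα, translate, ← Algebra.TensorProduct.one_def]
    change (leftShift f).baseChange A (α (1 ⊗ₜ b)) = α ((leftShift f).baseChange A (1 ⊗ₜ b))
    rw [LinearMap.baseChange_tmul, h1, h2, comul_leftShift]
    rfl
  rw [← trace_baseChange_leftShift, hx, hm, ← LinearMap.comp_assoc, hL, LinearMap.comp_assoc,
    LinearMap.trace_comp_comm', LinearMap.comp_assoc, LinearMap.comp_assoc, hβα,
    LinearMap.comp_id, trace_baseChange_leftShift, contract_tmul]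

theorem exists_traceForm_ne_zero [Module.Finite k A] : ∃ f : A →ₗ[k] k, traceForm f ≠ 0 := by
  by_contra! H
  let b := Module.finBasis k A
  -- The identity `a₁ S(a₂) = ε(a)` written in a basis. The right side has trace `ε(1) = 1`, while
  -- the trace of the left side is a sum of values of trace forms.
  have h1 : ∑ i, LinearMap.mulLeft k (HopfAlgebra.antipode k (b i)) ∘ₗ leftShift (b.coord i) =
      (Coalgebra.counit (R := k) (A := A)).smulRight 1 := by
    ext a
    have h2 := congrArg (LinearMap.mul' k A ∘ₗ (HopfAlgebra.antipode k).lTensor A)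
      (sum_contract_tmul b (Coalgebra.comul (R := k) a))
    rw [LinearMap.comp_apply _ _ (Coalgebra.comul a),
      HopfAlgebra.mul_antipode_lTensor_comul_apply, map_sum] at h2
    simp only [LinearMap.sum_apply, LinearMap.comp_apply, LinearMap.mulLeft_apply,
      LinearMap.smulRight_apply, leftShift]
    rw [← Algebra.algebraMap_eq_smul_one, ← h2]
    exact Finset.sum_congr rfl fun i _ => by simp [mul_comm]
  have h2 := congrArg (LinearMap.trace k A) h1
  rw [map_sum, LinearMap.trace_smulRight, Bialgebra.counit_one] at h2
  apply one_ne_zero (α := k)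
  rw [← h2]
  refine Finset.sum_eq_zero fun i _ => ?_
  rw [LinearMap.trace_comp_comm', ← traceForm_apply, H, LinearMap.zero_apply]

/-- The antipode, comultiplied and divided by the universal point of the second factor. -/
theorem comul_antipode_mul (b : A) :
    Algebra.TensorProduct.lmul' k (Algebra.TensorProduct.map
      ((Bialgebra.comulAlgHom k A).comp (HopfAlgebra.antipodeAlgHom k A))
      (Algebra.TensorProduct.includeLeft : A →ₐ[k] A ⊗[k] A) (Coalgebra.comul b)) =
      1 ⊗ₜ HopfAlgebra.antipode k b := by
  -- For universal points `x` and `y` this is `(xy)⁻¹ x = y⁻¹`.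
  have h : (WithConv.toConv (Bialgebra.comulAlgHom k A))⁻¹ * ι₁ = ι₂⁻¹ := by
    rw [toConv_comulAlgHom]
    exact (congrArg (fun z => z * ι₁) (mul_inv_rev ι₁ ι₂)).trans (inv_mul_cancel_right _ _)
  exact AlgHom.congr_fun (congrArg WithConv.ofConv h) b

/-- The pairing of the regular module with the dual algebra induced by a linear form. -/
noncomputable def pairing (l : A →ₗ[k] k) : A →ₗ[k] WithConv (A →ₗ[k] k) :=
  (WithConv.linearEquiv k (A →ₗ[k] k)).symm.toLinearMap ∘ₗ (LinearMap.mul k A).compr₂ l ∘ₗ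
    HopfAlgebra.antipode k

theorem pairing_apply (l : A →ₗ[k] k) (a x : A) :
    (pairing l a).ofConv x = l (HopfAlgebra.antipode k a * x) := rfl

/-- Expanding `l(S(b₁)x) b₂` by the integral property and collapsing `Δ(S(b₁))(b₂ ⊗ 1)` to `1 ⊗
S(b)` leaves `x₁ l(S(b)x₂)`; applying `r` gives the claim. -/
theorem pairing_smul {l : A →ₗ[k] k}
    (hl : ∀ x, contract A l (Coalgebra.comul x) = l x • (1 : A)) (r : WithConv (A →ₗ[k] k))
    (b : A) : pairing l (contract A r.ofConv (Coalgebra.comul b)) = r * pairing l b := by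
  refine WithConv.ext (LinearMap.ext fun x => ?_)
  rw [pairing_apply]
  let P : A ⊗[k] A →ₐ[k] A ⊗[k] A := (Algebra.TensorProduct.lmul' k).comp
    (Algebra.TensorProduct.map
      ((Bialgebra.comulAlgHom k A).comp (HopfAlgebra.antipodeAlgHom k A))
      (Algebra.TensorProduct.includeLeft : A →ₐ[k] A ⊗[k] A))
  have hP : P (Coalgebra.comul (b : A)) = 1 ⊗ₜ HopfAlgebra.antipode k (b : A) :=
    comul_antipode_mul b
  have hc : ∀ (q : A) (t : A ⊗[k] A), contract A l (t * (q ⊗ₜ 1)) = q * contract A l t := by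
    intro q t
    induction t using TensorProduct.induction_on with
    | zero => simp
    | add x y hx hy => simp only [map_add, add_mul, mul_add, hx, hy]
    | tmul v a => simp [mul_comm]
  have h1 : ∀ t : A ⊗[k] A, l (HopfAlgebra.antipode k (contract A r.ofConv t) * x) =
      r.ofConv (contract A l (P t * Coalgebra.comul x)) := by
    intro t
    induction t using TensorProduct.induction_on with
    | zero => simp
    | add x y hx hy => simp only [map_add, add_mul, hx, hy]
    | tmul p q =>
      have : P (p ⊗ₜ q) * Coalgebra.comul x =
          Coalgebra.comul (HopfAlgebra.antipode k p * x) * (q ⊗ₜ 1) := by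
        simp only [P, AlgHom.comp_apply, Algebra.TensorProduct.map_tmul,
          Algebra.TensorProduct.lmul'_apply_tmul, Bialgebra.comul_mul]
        exact mul_right_comm _ _ _
      rw [this, hc, hl]
      simp [mul_comm]
  have h2 : ∀ t : A ⊗[k] A,
      r.ofConv (contract A l ((1 ⊗ₜ HopfAlgebra.antipode k (b : A)) * t)) =
        LinearMap.mul' k k (TensorProduct.map r.ofConv (pairing l b).ofConv t) := by
    intro t
    induction t using TensorProduct.induction_on with
    | zero => simp
    | add x y hx hy => simp only [map_add, mul_add, hx, hy]
    | tmul v a => simp [pairing_apply, mul_comm]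
  refine (h1 _).trans ?_
  refine (congrArg (fun z => r.ofConv (contract A l (z * Coalgebra.comul x))) hP).trans ?_
  exact h2 _

/-- The kernel is an ideal stable under the dual algebra. With `y` it contains `y₁ S(y₂) = ε(y)1`,
and `l ≠ 0` forces `ε(y) = 0`. Applied to `r • y`, whose counit is `r(y)`, this kills `y`. -/
theorem pairing_injective [Module.Finite k A] {l : A →ₗ[k] k} (hl0 : l ≠ 0)
    (hl : ∀ x, contract A l (Coalgebra.comul x) = l x • (1 : A)) :
    Function.Injective (pairing l) := by
  have hmul : ∀ y z : A, pairing l y = 0 → pairing l (y * z) = 0 := by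
    intro y z hy
    refine WithConv.ext (LinearMap.ext fun x => ?_)
    rw [pairing_apply, HopfAlgebra.antipode_mul_distrib, mul_assoc, ← pairing_apply, hy]
    rfl
  have hε : ∀ y : A, pairing l y = 0 → Coalgebra.counit (R := k) y = 0 := by
    intro y hy
    let b := Module.finBasis k A
    have h2 := congrArg (LinearMap.mul' k A ∘ₗ (HopfAlgebra.antipode k).lTensor A)
      (sum_contract_tmul b (Coalgebra.comul (R := k) y))
    rw [LinearMap.comp_apply _ _ (Coalgebra.comul y),
      HopfAlgebra.mul_antipode_lTensor_comul_apply, map_sum] at h2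
    have h3 : pairing l (algebraMap k A (Coalgebra.counit y)) = 0 := by
      rw [← h2, map_sum]
      refine Finset.sum_eq_zero fun i _ => ?_
      simp only [LinearMap.comp_apply, LinearMap.lTensor_tmul, LinearMap.mul'_apply]
      refine hmul _ _ ?_
      have := pairing_smul hl (WithConv.toConv (b.coord i)) y
      rw [hy, mul_zero] at this
      exact this
    by_contra h0
    apply hl0
    ext x
    have h4 := LinearMap.congr_fun (congrArg WithConv.ofConv h3) x
    rw [pairing_apply, Algebra.algebraMap_eq_smul_one, map_smul, HopfAlgebra.antipode_one,
      smul_mul_assoc, one_mul, map_smul] at h4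
    exact (smul_eq_zero.1 h4).resolve_left h0
  rw [injective_iff_map_eq_zero]
  intro y hy
  rw [← Module.forall_dual_apply_eq_zero_iff k]
  intro r
  have h1 := pairing_smul hl (WithConv.toConv r) y
  rw [hy, mul_zero] at h1
  have h2 := hε _ h1
  have h3 : ∀ t : A ⊗[k] A, Coalgebra.counit (R := k) (contract A r t) =
      r (TensorProduct.lid k A ((Coalgebra.counit (R := k) (A := A)).rTensor A t)) := by
    intro t
    induction t using TensorProduct.induction_on with
    | zero => simp
    | add x y hx hy => simp only [map_add, hx, hy]
    | tmul v a => simp [mul_comm]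
  have h4 := (h3 (Coalgebra.comul y)).symm.trans h2
  rwa [Coalgebra.rTensor_counit_comul, TensorProduct.lid_tmul, one_smul] at h4

/-- A finite-dimensional commutative Hopf algebra is a free module of rank one over its dual. -/
theorem nonempty_regular_equiv (k A : Type u) [Field k] [CommRing A] [HopfAlgebra k A]
    [Module.Finite k A] :
    Nonempty ((regular k A).carrier ≃ₗ[WithConv (A →ₗ[k] k)] WithConv (A →ₗ[k] k)) := by
  obtain ⟨f, hf⟩ := exists_traceForm_ne_zero (k := k) (A := A)
  have hinj := pairing_injective hf (contract_traceForm_comul f)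
  have hfin : Module.Finite k (WithConv (A →ₗ[k] k)) :=
    Module.Finite.equiv (WithConv.linearEquiv k (A →ₗ[k] k)).symm
  have hsurj : Function.Surjective (pairing (traceForm f)) := by
    rw [← LinearMap.injective_iff_surjective_of_finrank_eq_finrank]
    · exact hinj
    · rw [(WithConv.linearEquiv k (A →ₗ[k] k)).finrank_eq]
      exact (Subspace.dual_finrank_eq (K := k) (V := A)).symm
  let F : (regular k A).carrier →ₗ[WithConv (A →ₗ[k] k)] WithConv (A →ₗ[k] k) :=
    { toFun := pairing (traceForm f)
      map_add' := map_add (pairing (traceForm f))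
      map_smul' := pairing_smul (contract_traceForm_comul f) }
  exact ⟨LinearEquiv.ofBijective F ⟨hinj, hsurj⟩⟩

end Frobenius

/-! ### Cofree modules and injectivity -/

section Cofree

variable {k A : Type u} [Field k] [CommRing A] [HopfAlgebra k A]

theorem assoc_symm_comul_mk {V : Type u} [AddCommGroup V] [Module k V] (v : V) :
    ((TensorProduct.assoc k V A A).symm.toLinearMap ∘ₗ
      (Coalgebra.comul (R := k) (A := A)).lTensor V) ∘ₗ TensorProduct.mk k V A v =
      (TensorProduct.mk k V A v).rTensor A ∘ₗ Coalgebra.comul := by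
  refine LinearMap.ext fun a => ?_
  change (TensorProduct.assoc k V A A).symm (v ⊗ₜ Coalgebra.comul a) =
    (TensorProduct.mk k V A v).rTensor A (Coalgebra.comul a)
  induction Coalgebra.comul (R := k) a using TensorProduct.induction_on with
  | zero => simp
  | add x y hx hy => simp only [map_add, TensorProduct.tmul_add, hx, hy]
  | tmul x y => simp

/-- The cofree rational module `V ⊗ k[G]` on a vector space `V`. -/
noncomputable def cofree (k A : Type u) [Field k] [CommRing A] [HopfAlgebra k A] (V : Type u)
    [AddCommGroup V] [Module k V] : RatMod k A where
  carrier := V ⊗[k] A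
  coact := (TensorProduct.assoc k V A A).symm.toLinearMap ∘ₗ
    (Coalgebra.comul (R := k) (A := A)).lTensor V
  coassoc := TensorProduct.ext (LinearMap.ext fun v =>
    coassoc_comp (regular k A) (W := V ⊗[k] A) _ (TensorProduct.mk k V A v)
      (assoc_symm_comul_mk (k := k) (A := A) v))
  counit_coact := TensorProduct.ext (LinearMap.ext fun v =>
    counit_comp (regular k A) (W := V ⊗[k] A) _ (TensorProduct.mk k V A v)
      (assoc_symm_comul_mk (k := k) (A := A) v))

variable {V₀ : Type u} [AddCommGroup V₀] [Module k V₀]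

/-- The embedding of the regular module into a cofree module given by a vector. -/
noncomputable def cofreeMk (v : V₀) : (regular k A).carrier →ₗ[k] (cofree k A V₀).carrier :=
  TensorProduct.mk k V₀ A v

theorem isHom_cofreeMk (v : V₀) : IsHom (regular k A) (cofree k A V₀) (cofreeMk v) :=
  assoc_symm_comul_mk (k := k) (A := A) v

/-- The homomorphism into a cofree module induced by a linear map. -/
noncomputable def cofreeLift (V : RatMod k A) (f : V.carrier →ₗ[k] V₀) :
    V.carrier →ₗ[k] (cofree k A V₀).carrier :=
  f.rTensor A ∘ₗ V.coact

/-- Evaluation at the unit element on a cofree module. -/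
noncomputable def cofreeEv (k A : Type u) [Field k] [CommRing A] [HopfAlgebra k A] (V : Type u)
    [AddCommGroup V] [Module k V] : (cofree k A V).carrier →ₗ[k] V :=
  contract V (Coalgebra.counit (R := k) (A := A))

theorem isHom_cofreeLift (V : RatMod k A) (f : V.carrier →ₗ[k] V₀) :
    IsHom V (cofree k A V₀) (cofreeLift V f) := by
  change ((TensorProduct.assoc k V₀ A A).symm.toLinearMap ∘ₗ
    (Coalgebra.comul (R := k) (A := A)).lTensor V₀) ∘ₗ (f.rTensor A ∘ₗ V.coact) =
      (f.rTensor A ∘ₗ V.coact).rTensor A ∘ₗ V.coact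
  rw [LinearMap.rTensor_comp, LinearMap.comp_assoc,
    ← LinearMap.comp_assoc _ _ (LinearMap.lTensor _ _), LinearMap.lTensor_comp_rTensor,
    ← LinearMap.rTensor_comp_lTensor, LinearMap.comp_assoc, ← V.coassoc,
    ← LinearMap.comp_assoc _ _ (LinearMap.rTensor (A ⊗[k] A) f), ← assoc_rTensor]
  ext v
  simp

theorem cofreeEv_cofreeLift (V : RatMod k A) (f : V.carrier →ₗ[k] V₀) :
    cofreeEv k A V₀ ∘ₗ cofreeLift V f = f := by
  ext v
  refine (contract_rTensor _ f (V.coact v)).trans (congrArg f ?_)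
  have := LinearMap.congr_fun V.counit_coact v
  simp only [LinearMap.comp_apply] at this
  rw [contract, LinearMap.comp_apply, this]
  simp

/-- With `cofreeEv_cofreeLift` this is the adjunction between forgetting the coaction and the cofree
module. -/
theorem cofreeLift_cofreeEv {V : RatMod k A} {f : V.carrier →ₗ[k] (cofree k A V₀).carrier}
    (hf : IsHom V (cofree k A V₀) f) :
    cofreeLift V (cofreeEv k A V₀ ∘ₗ f) = f := by
  have h1 : ∀ t : V₀ ⊗[k] A, (contract V₀ (Coalgebra.counit (R := k) (A := A))).rTensor A
      ((TensorProduct.assoc k V₀ A A).symm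
        ((Coalgebra.comul (R := k) (A := A)).lTensor V₀ t)) = t := by
    intro t
    induction t using TensorProduct.induction_on with
    | zero => simp
    | add x y hx hy => simp only [map_add, hx, hy]
    | tmul v a =>
      have h2 : ∀ s : A ⊗[k] A, (contract V₀ (Coalgebra.counit (R := k) (A := A))).rTensor A
          ((TensorProduct.assoc k V₀ A A).symm (v ⊗ₜ s)) =
          v ⊗ₜ TensorProduct.lid k A ((Coalgebra.counit (R := k) (A := A)).rTensor A s) := by
        intro s
        induction s using TensorProduct.induction_on with
        | zero => simp
        | add x y hx hy => simp only [map_add, TensorProduct.tmul_add, hx, hy]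
        | tmul x y => simp [TensorProduct.smul_tmul]
      rw [LinearMap.lTensor_tmul, h2, Coalgebra.rTensor_counit_comul, TensorProduct.lid_tmul,
        one_smul]
  ext v
  change (cofreeEv k A V₀ ∘ₗ f).rTensor A (V.coact v) = f v
  rw [LinearMap.rTensor_comp, LinearMap.comp_apply, ← hf.apply]
  exact h1 (f v)

theorem cofreeLift_comp {V W : RatMod k A} {g : V.carrier →ₗ[k] W.carrier} (hg : IsHom V W g)
    (f : W.carrier →ₗ[k] V₀) : cofreeLift W f ∘ₗ g = cofreeLift V (f ∘ₗ g) := by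
  have : f.rTensor A ∘ₗ W.coact ∘ₗ g = (f ∘ₗ g).rTensor A ∘ₗ V.coact := by
    rw [hg, LinearMap.rTensor_comp, LinearMap.comp_assoc]
  exact this

-- By adjunction, extending a homomorphism into a cofree module means extending a linear map, and a
-- linear retraction of `g` does that.
variable (V₀) in
theorem isInjective_cofree : IsInjective (cofree k A V₀) := by
  intro X Y g f hg hgi hf
  obtain ⟨s, hs⟩ := g.exists_leftInverse_of_injective (LinearMap.ker_eq_bot.2 hgi)
  refine ⟨cofreeLift Y (cofreeEv k A V₀ ∘ₗ f ∘ₗ s),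
    isHom_cofreeLift Y _, ?_⟩
  rw [cofreeLift_comp hg, LinearMap.comp_assoc, LinearMap.comp_assoc, hs, LinearMap.comp_id,
    cofreeLift_cofreeEv hf]

theorem coact_injective (V : RatMod k A) :
    Function.Injective (cofreeLift V (LinearMap.id : V.carrier →ₗ[k] V.carrier)) := by
  have := cofreeEv_cofreeLift V (LinearMap.id : V.carrier →ₗ[k] V.carrier)
  exact Function.LeftInverse.injective (g := cofreeEv k A V.carrier)
    fun v => LinearMap.congr_fun this v

theorem IsInjective.of_retract {I V : RatMod k A} (hI : IsInjective I)
    {i : V.carrier →ₗ[k] I.carrier} {p : I.carrier →ₗ[k] V.carrier} (hi : IsHom V I i)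
    (hp : IsHom I V p) (hpi : p ∘ₗ i = LinearMap.id) : IsInjective V := by
  intro X Y g f hg hgi hf
  obtain ⟨h, hh, hhg⟩ := hI X Y g (i ∘ₗ f) hg hgi (hi.comp hf)
  exact ⟨p ∘ₗ h, hp.comp hh, by
    rw [LinearMap.comp_assoc, hhg, ← LinearMap.comp_assoc, hpi, LinearMap.id_comp]⟩

end Cofree

/-! ### Finite group schemes: projective equals injective -/

section Frobenius

variable {k A : Type u} [Field k] [CommRing A] [HopfAlgebra k A] [Module.Finite k A]

theorem nonempty_cofree_equiv {V₀ : Type u} [AddCommGroup V₀] [Module k V₀] {ι : Type u}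
    (b : Module.Basis ι k V₀) :
    Nonempty ((cofree k A V₀).carrier ≃ₗ[WithConv (A →ₗ[k] k)] (ι →₀ WithConv (A →ₗ[k] k))) := by
  obtain ⟨φ⟩ := nonempty_regular_equiv k A
  classical
  let g : (ι →₀ (regular k A).carrier) →ₗ[WithConv (A →ₗ[k] k)] (cofree k A V₀).carrier :=
    Finsupp.lsum ℕ fun i => (isHom_cofreeMk (A := A) (b i)).toDual
  let e : V₀ ⊗[k] A ≃ₗ[k] (ι →₀ A) :=
    (TensorProduct.congr b.repr (LinearEquiv.refl k A)).trans
      (TensorProduct.finsuppScalarLeft k A ι)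
  have hg : ∀ x : ι →₀ A, g x = e.symm x := by
    intro x
    induction x using Finsupp.induction_linear with
    | zero => rw [map_zero]; exact g.map_zero
    | add x y hx hy =>
      rw [map_add, ← hx, ← hy]; exact g.map_add _ _
    | single i a =>
      have h1 : g (Finsupp.single i a) = b i ⊗ₜ[k] a :=
        Finsupp.lsum_single ℕ (fun i => (isHom_cofreeMk (A := A) (b i)).toDual) i a
      have h2 : b i ⊗ₜ[k] a = e.symm (Finsupp.single i a) := by simp [e]
      exact h1.trans h2
  have hbij : Function.Bijective g := by
    have : (g : (ι →₀ A) → V₀ ⊗[k] A) = e.symm := funext hg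
    exact this ▸ e.symm.bijective
  exact ⟨(LinearEquiv.ofBijective g hbij).symm.trans (Finsupp.mapRange.linearEquiv φ)⟩

theorem projective_cofree (V₀ : Type u) [AddCommGroup V₀] [Module k V₀] :
    Module.Projective (WithConv (A →ₗ[k] k)) (cofree k A V₀).carrier := by
  obtain ⟨e⟩ := nonempty_cofree_equiv (A := A) (Module.Basis.ofVectorSpace k V₀)
  exact Module.Projective.of_equiv e.symm

/-- Every rational module is a quotient of a cofree module. -/
theorem exists_surjective_cofree (V : RatMod k A) :
    ∃ g : (cofree k A V.carrier).carrier →ₗ[k] V.carrier,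
      IsHom (cofree k A V.carrier) V g ∧ Function.Surjective g := by
  let b := Module.Basis.ofVectorSpace k V.carrier
  obtain ⟨e⟩ := nonempty_cofree_equiv (A := A) b
  have hs : Function.Surjective (Finsupp.linearCombination (WithConv (A →ₗ[k] k)) b) := by
    rw [← LinearMap.range_eq_top, Finsupp.range_linearCombination, eq_top_iff]
    intro v _
    have h1 : v ∈ Submodule.span k (Set.range b) := by rw [b.span_eq]; trivial
    exact Submodule.span_subset_span k (WithConv (A →ₗ[k] k)) _ h1
  exact ⟨_, isHom_restrictScalars (Finsupp.linearCombination (WithConv (A →ₗ[k] k)) b ∘ₗ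
    e.toLinearMap), hs.comp e.surjective⟩

theorem isProjective_of_projective {V : RatMod k A}
    (hV : Module.Projective (WithConv (A →ₗ[k] k)) V.carrier) : IsProjective V := by
  intro X Y g f hg hgs hf
  obtain ⟨h, hh⟩ := Module.projective_lifting_property hg.toDual hf.toDual hgs
  exact ⟨h.restrictScalars k, isHom_restrictScalars h, LinearMap.ext fun v => LinearMap.congr_fun hh v⟩

theorem IsProjective.projective {V : RatMod k A} (hV : IsProjective V) :
    Module.Projective (WithConv (A →ₗ[k] k)) V.carrier := by
  obtain ⟨g, hg, hgs⟩ := exists_surjective_cofree V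
  obtain ⟨h, hh, hgh⟩ := hV _ _ g (LinearMap.id : V.carrier →ₗ[k] V.carrier) hg hgs (IsHom.id V)
  have := projective_cofree (k := k) (A := A) V.carrier
  exact Module.Projective.of_split hh.toDual hg.toDual (LinearMap.ext fun v => LinearMap.congr_fun hgh v)

/-- An injective module splits off the cofree module it embeds in, which is free over the dual
algebra. The converse splits a projective off a cofree cover. -/
theorem IsInjective.isProjective {V : RatMod k A} (hV : IsInjective V) : IsProjective V := by
  obtain ⟨h, hh, hgh⟩ := hV _ _ (cofreeLift V LinearMap.id) LinearMap.id (isHom_cofreeLift V _)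
    (coact_injective V) (IsHom.id V)
  have := projective_cofree (k := k) (A := A) V.carrier
  exact isProjective_of_projective (Module.Projective.of_split (isHom_cofreeLift V _).toDual
    hh.toDual (LinearMap.ext fun v => LinearMap.congr_fun hgh v))

theorem IsProjective.isInjective {V : RatMod k A} (hV : IsProjective V) : IsInjective V := by
  obtain ⟨g, hg, hgs⟩ := exists_surjective_cofree V
  obtain ⟨h, hh, hgh⟩ := hV _ _ g (LinearMap.id : V.carrier →ₗ[k] V.carrier) hg hgs (IsHom.id V)
  exact (isInjective_cofree V.carrier).of_retract hh hg hgh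

end Frobenius

/-! ### Multiplying coefficients in tensor products -/

section MulTensor

variable {k : Type u} [Field k] {V W V' W' : Type u} [AddCommGroup V] [Module k V]
  [AddCommGroup W] [Module k W] [AddCommGroup V'] [Module k V'] [AddCommGroup W'] [Module k W']
  (C : Type u) [CommRing C] [Algebra k C]

/-- The multiplication `(V ⊗ C) × (W ⊗ C) → (V ⊗ W) ⊗ C`. -/
noncomputable def mulTensor (V W : Type u) [AddCommGroup V] [Module k V] [AddCommGroup W]
    [Module k W] : V ⊗[k] C →ₗ[k] W ⊗[k] C →ₗ[k] (V ⊗[k] W) ⊗[k] C :=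
  (TensorProduct.mk k (V ⊗[k] C) (W ⊗[k] C)).compr₂
    ((LinearMap.mul' k C).lTensor (V ⊗[k] W) ∘ₗ
      (TensorProduct.tensorTensorTensorComm k V C W C).toLinearMap)

@[simp]
theorem mulTensor_tmul (v : V) (w : W) (a b : C) :
    mulTensor (k := k) C V W (v ⊗ₜ a) (w ⊗ₜ b) = (v ⊗ₜ w) ⊗ₜ (a * b) := by
  simp [mulTensor]

/-- Two bilinear maps on `(V ⊗ C) × (W ⊗ C)` agree if they agree on pure tensors. -/
theorem mulTensor_ext {U : Type u} [AddCommGroup U] [Module k U]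
    {f g : V ⊗[k] C →ₗ[k] W ⊗[k] C →ₗ[k] U}
    (h : ∀ v a w b, f (v ⊗ₜ a) (w ⊗ₜ b) = g (v ⊗ₜ a) (w ⊗ₜ b)) : f = g := by
  ext v a w b
  exact h v a w b

theorem map_mulTensor (f : V →ₗ[k] V') (g : W →ₗ[k] W') (x : V ⊗[k] C) (y : W ⊗[k] C) :
    (TensorProduct.map f g).rTensor C (mulTensor C V W x y) =
      mulTensor C V' W' (f.rTensor C x) (g.rTensor C y) := by
  have : (mulTensor C V W).compr₂ ((TensorProduct.map f g).rTensor C) =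
      (mulTensor C V' W').compl₁₂ (f.rTensor C) (g.rTensor C) :=
    mulTensor_ext C fun v a w b => by simp
  exact LinearMap.congr_fun (LinearMap.congr_fun this x) y

theorem lTensor_mulTensor {D : Type u} [CommRing D] [Algebra k D] (φ : C →ₐ[k] D)
    (x : V ⊗[k] C) (y : W ⊗[k] C) :
    φ.toLinearMap.lTensor (V ⊗[k] W) (mulTensor C V W x y) =
      mulTensor D V W (φ.toLinearMap.lTensor V x) (φ.toLinearMap.lTensor W y) := by
  have : (mulTensor C V W).compr₂ (φ.toLinearMap.lTensor (V ⊗[k] W)) =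
      (mulTensor D V W).compl₁₂ (φ.toLinearMap.lTensor V) (φ.toLinearMap.lTensor W) :=
    mulTensor_ext C fun v a w b => by simp
  exact LinearMap.congr_fun (LinearMap.congr_fun this x) y

theorem assoc_mulTensor_tmul (x : V ⊗[k] C) (y : W ⊗[k] C) (a b : C) :
    TensorProduct.assoc k (V ⊗[k] W) C C (mulTensor C V W x y ⊗ₜ (a * b)) =
      mulTensor (C ⊗[k] C) V W (TensorProduct.assoc k V C C (x ⊗ₜ a))
        (TensorProduct.assoc k W C C (y ⊗ₜ b)) := by
  have : (mulTensor C V W).compr₂ ((TensorProduct.assoc k (V ⊗[k] W) C C).toLinearMap ∘ₗ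
      (TensorProduct.mk k ((V ⊗[k] W) ⊗[k] C) C).flip (a * b)) =
      (mulTensor (C ⊗[k] C) V W).compl₁₂
        ((TensorProduct.assoc k V C C).toLinearMap ∘ₗ (TensorProduct.mk k (V ⊗[k] C) C).flip a)
        ((TensorProduct.assoc k W C C).toLinearMap ∘ₗ (TensorProduct.mk k (W ⊗[k] C) C).flip b) :=
    mulTensor_ext C fun v a w b => by simp
  exact LinearMap.congr_fun (LinearMap.congr_fun this x) y

theorem assoc_rTensor_mulTensor (ρ : V →ₗ[k] V ⊗[k] C) (σ : W →ₗ[k] W ⊗[k] C)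
    (τ : V ⊗[k] W →ₗ[k] (V ⊗[k] W) ⊗[k] C)
    (hτ : ∀ v w, τ (v ⊗ₜ w) = mulTensor C V W (ρ v) (σ w)) (x : V ⊗[k] C) (y : W ⊗[k] C) :
    TensorProduct.assoc k (V ⊗[k] W) C C (τ.rTensor C (mulTensor C V W x y)) =
      mulTensor (C ⊗[k] C) V W (TensorProduct.assoc k V C C (ρ.rTensor C x))
        (TensorProduct.assoc k W C C (σ.rTensor C y)) := by
  have : (mulTensor C V W).compr₂ ((TensorProduct.assoc k (V ⊗[k] W) C C).toLinearMap ∘ₗ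
      τ.rTensor C) = (mulTensor (C ⊗[k] C) V W).compl₁₂
        ((TensorProduct.assoc k V C C).toLinearMap ∘ₗ ρ.rTensor C)
        ((TensorProduct.assoc k W C C).toLinearMap ∘ₗ σ.rTensor C) :=
    mulTensor_ext C fun v a w b => by
      simpa [hτ] using assoc_mulTensor_tmul C (ρ v) (σ w) a b
  exact LinearMap.congr_fun (LinearMap.congr_fun this x) y

end MulTensor

/-! ### Tensor products and the tensor identity -/

section Tensor

variable {k A : Type u} [Field k] [CommRing A] [HopfAlgebra k A]

/-- The coaction on a tensor product. -/
noncomputable def tensorCoact (V W : RatMod k A) :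
    V.carrier ⊗[k] W.carrier →ₗ[k] (V.carrier ⊗[k] W.carrier) ⊗[k] A :=
  TensorProduct.lift ((mulTensor A V.carrier W.carrier).compl₁₂ V.coact W.coact)

theorem tensorCoact_tmul (V W : RatMod k A) (v : V.carrier) (w : W.carrier) :
    tensorCoact V W (v ⊗ₜ w) = mulTensor A V.carrier W.carrier (V.coact v) (W.coact w) := rfl

/-- The tensor product of rational modules. -/
noncomputable def tensor (V W : RatMod k A) : RatMod k A where
  carrier := V.carrier ⊗[k] W.carrier
  coact := tensorCoact V W
  coassoc := by
    refine TensorProduct.ext' fun v w => ?_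
    have h := lTensor_mulTensor A (Bialgebra.comulAlgHom k A) (V.coact v) (W.coact w)
    have h1 := LinearMap.congr_fun V.coassoc v
    have h2 := LinearMap.congr_fun W.coassoc w
    simp only [LinearMap.comp_apply, LinearEquiv.coe_coe] at h1 h2 ⊢
    rw [tensorCoact_tmul, assoc_rTensor_mulTensor A V.coact W.coact _ (tensorCoact_tmul V W), h1,
      h2]
    exact h.symm
  counit_coact := by
    refine TensorProduct.ext' fun v w => ?_
    have h := lTensor_mulTensor A (Bialgebra.counitAlgHom k A) (V.coact v) (W.coact w)
    have h1 := LinearMap.congr_fun V.counit_coact v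
    have h2 := LinearMap.congr_fun W.counit_coact w
    rw [LinearMap.comp_apply, tensorCoact_tmul]
    refine h.trans ?_
    refine (congrArg₂ (fun x y => mulTensor k V.carrier W.carrier x y) h1 h2).trans ?_
    simp

/-- The tensor product of linear maps between rational modules. -/
noncomputable def tensorMap {V W V' W' : RatMod k A} (f : V.carrier →ₗ[k] V'.carrier)
    (g : W.carrier →ₗ[k] W'.carrier) : (tensor V W).carrier →ₗ[k] (tensor V' W').carrier :=
  TensorProduct.map f g

theorem isHom_tensorMap {V W V' W' : RatMod k A} {f : V.carrier →ₗ[k] V'.carrier}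
    {g : W.carrier →ₗ[k] W'.carrier} (hf : IsHom V V' f) (hg : IsHom W W' g) :
    IsHom (tensor V W) (tensor V' W') (tensorMap f g) := by
  refine TensorProduct.ext' fun v w => ?_
  have h := map_mulTensor A f g (V.coact v) (W.coact w)
  rw [← hf.apply, ← hg.apply] at h
  exact h.symm

theorem res_tensor_coact {B : Type u} [CommRing B] [HopfAlgebra k B] (π : A →ₐc[k] B)
    (V W : RatMod k A) : ((tensor V W).res π).coact = (tensor (V.res π) (W.res π)).coact :=
  TensorProduct.ext' fun v w => lTensor_mulTensor A (π : A →ₐ[k] B) (V.coact v) (W.coact w)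

theorem IsHom.res {B : Type u} [CommRing B] [HopfAlgebra k B] (π : A →ₐc[k] B)
    {V W : RatMod k A} {f : V.carrier →ₗ[k] W.carrier} (hf : IsHom V W f) :
    IsHom (V.res π) (W.res π) f := by
  change (((π : A →ₗc[k] B) : A →ₗ[k] B).lTensor W.carrier ∘ₗ W.coact) ∘ₗ f =
    f.rTensor B ∘ₗ ((π : A →ₗc[k] B) : A →ₗ[k] B).lTensor V.carrier ∘ₗ V.coact
  rw [LinearMap.comp_assoc, hf, ← LinearMap.comp_assoc, LinearMap.lTensor_comp_rTensor,
    ← LinearMap.rTensor_comp_lTensor, LinearMap.comp_assoc]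

theorem isHom_res_tensor {B : Type u} [CommRing B] [HopfAlgebra k B] (π : A →ₐc[k] B)
    (V W : RatMod k A) : IsHom ((tensor V W).res π) (tensor (V.res π) (W.res π))
      (LinearMap.id : V.carrier ⊗[k] W.carrier →ₗ[k] V.carrier ⊗[k] W.carrier) := by
  have h := res_tensor_coact π V W
  have h2 : (LinearMap.id : V.carrier ⊗[k] W.carrier →ₗ[k] V.carrier ⊗[k] W.carrier).rTensor B =
      LinearMap.id := LinearMap.rTensor_id _ _
  refine LinearMap.ext fun x => ?_
  refine (LinearMap.congr_fun h x).symm.trans ?_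
  exact (LinearMap.congr_fun h2 _).symm

theorem isHom_tensor_res {B : Type u} [CommRing B] [HopfAlgebra k B] (π : A →ₐc[k] B)
    (V W : RatMod k A) : IsHom (tensor (V.res π) (W.res π)) ((tensor V W).res π)
      (LinearMap.id : V.carrier ⊗[k] W.carrier →ₗ[k] V.carrier ⊗[k] W.carrier) := by
  have h := res_tensor_coact π V W
  have h2 : (LinearMap.id : V.carrier ⊗[k] W.carrier →ₗ[k] V.carrier ⊗[k] W.carrier).rTensor B =
      LinearMap.id := LinearMap.rTensor_id _ _
  refine LinearMap.ext fun x => ?_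
  refine (LinearMap.congr_fun h x).trans ?_
  exact (LinearMap.congr_fun h2 _).symm

theorem antipode_coact_left (W : RatMod k A) (w : W.carrier) :
    (LinearMap.mul' k A ∘ₗ (HopfAlgebra.antipode k).rTensor A).lTensor W.carrier
      (TensorProduct.assoc k _ _ _ (W.coact.rTensor A (W.coact w))) = w ⊗ₜ 1 := by
  have h1 := LinearMap.congr_fun W.coassoc w
  have h2 := LinearMap.congr_fun W.counit_coact w
  simp only [LinearMap.comp_apply, LinearEquiv.coe_coe] at h1 h2
  rw [h1, ← LinearMap.comp_apply (LinearMap.lTensor _ _), ← LinearMap.lTensor_comp,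
    LinearMap.comp_assoc, HopfAlgebra.mul_antipode_rTensor_comul, LinearMap.lTensor_comp,
    LinearMap.comp_apply, h2]
  simp

theorem antipode_coact_right (W : RatMod k A) (w : W.carrier) :
    (LinearMap.mul' k A ∘ₗ (HopfAlgebra.antipode k).lTensor A).lTensor W.carrier
      (TensorProduct.assoc k _ _ _ (W.coact.rTensor A (W.coact w))) = w ⊗ₜ 1 := by
  have h1 := LinearMap.congr_fun W.coassoc w
  have h2 := LinearMap.congr_fun W.counit_coact w
  simp only [LinearMap.comp_apply, LinearEquiv.coe_coe] at h1 h2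
  rw [h1, ← LinearMap.comp_apply (LinearMap.lTensor _ _), ← LinearMap.lTensor_comp,
    LinearMap.comp_assoc, HopfAlgebra.mul_antipode_lTensor_comul, LinearMap.lTensor_comp,
    LinearMap.comp_apply, h2]
  simp

section Identity

variable (V₀ : Type u) [AddCommGroup V₀] [Module k V₀] (W : RatMod k A)

/-- The tensor identity, as a linear map `(V ⊗ k[G]) ⊗ W → (V ⊗ W) ⊗ k[G]`. -/
noncomputable def tensorIdentity :
    (V₀ ⊗[k] A) ⊗[k] W.carrier →ₗ[k] (V₀ ⊗[k] W.carrier) ⊗[k] A :=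
  TensorProduct.lift ((mulTensor A V₀ W.carrier).compl₂ W.coact)

theorem tensorIdentity_tmul (x : V₀ ⊗[k] A) (w : W.carrier) :
    tensorIdentity V₀ W (x ⊗ₜ w) = mulTensor A V₀ W.carrier x (W.coact w) := rfl

/-- The inverse of the tensor identity. -/
noncomputable def tensorIdentityInv :
    (V₀ ⊗[k] W.carrier) ⊗[k] A →ₗ[k] (V₀ ⊗[k] A) ⊗[k] W.carrier :=
  (TensorProduct.rightComm k V₀ W.carrier A).toLinearMap ∘ₗ
    (LinearMap.mul' k A ∘ₗ (HopfAlgebra.antipode k).rTensor A).lTensor (V₀ ⊗[k] W.carrier) ∘ₗ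
      (TensorProduct.assoc k (V₀ ⊗[k] W.carrier) A A).toLinearMap ∘ₗ
        ((TensorProduct.assoc k V₀ W.carrier A).symm.toLinearMap ∘ₗ
          W.coact.lTensor V₀).rTensor A

/-- The maps are `(v ⊗ a) ⊗ w ↦ (v ⊗ w₀) ⊗ a w₁` and `(v ⊗ w) ⊗ a ↦ (v ⊗ S(w₁)a) ⊗ w₀`; the
composite reduces to `w₀ ⊗ S(w₁)w₂ = w ⊗ 1`. -/
theorem tensorIdentityInv_comp :
    tensorIdentityInv V₀ W ∘ₗ tensorIdentity V₀ W = LinearMap.id := by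
  ext v a w
  have h1 : ∀ y : W.carrier ⊗[k] A,
      tensorIdentityInv V₀ W (mulTensor A V₀ W.carrier (v ⊗ₜ a) y) =
      (TensorProduct.rightComm k V₀ W.carrier A) ((TensorProduct.assoc k V₀ W.carrier A).symm
        (v ⊗ₜ ((LinearMap.mulLeft k a).lTensor W.carrier
        ((LinearMap.mul' k A ∘ₗ (HopfAlgebra.antipode k).rTensor A).lTensor W.carrier
      (TensorProduct.assoc k _ _ _ (W.coact.rTensor A y)))))) := by
    intro y
    induction y using TensorProduct.induction_on with
    | zero => simp
    | add x y hx hy => simp only [map_add, TensorProduct.tmul_add, hx, hy]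
    | tmul w b =>
      rw [mulTensor_tmul, LinearMap.rTensor_tmul, tensorIdentityInv]
      simp only [LinearMap.comp_apply, LinearMap.rTensor_tmul, LinearMap.lTensor_tmul]
      induction W.coact w using TensorProduct.induction_on with
      | zero => simp
      | add x y hx hy =>
        simp only [map_add, TensorProduct.tmul_add, TensorProduct.add_tmul, hx, hy]
      | tmul w' c => simp [mul_left_comm]
  have h2 := h1 (W.coact w)
  rw [antipode_coact_left] at h2
  simpa [tensorIdentity_tmul] using h2

theorem tensorIdentity_comp :
    tensorIdentity V₀ W ∘ₗ tensorIdentityInv V₀ W = LinearMap.id := by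
  ext v w a
  have h1 : ∀ y : W.carrier ⊗[k] A,
      tensorIdentity V₀ W (TensorProduct.rightComm k V₀ W.carrier A
        ((LinearMap.mul' k A ∘ₗ (HopfAlgebra.antipode k).rTensor A).lTensor (V₀ ⊗[k] W.carrier)
          (TensorProduct.assoc k (V₀ ⊗[k] W.carrier) A A
            ((TensorProduct.assoc k V₀ W.carrier A).symm (v ⊗ₜ y) ⊗ₜ a)))) =
      (TensorProduct.assoc k V₀ W.carrier A).symm
        (v ⊗ₜ ((LinearMap.mulLeft k a).lTensor W.carrier
        ((LinearMap.mul' k A ∘ₗ (HopfAlgebra.antipode k).lTensor A).lTensor W.carrier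
      (TensorProduct.assoc k _ _ _ (W.coact.rTensor A y))))) := by
    intro y
    induction y using TensorProduct.induction_on with
    | zero => simp
    | add x y hx hy => simp only [map_add, TensorProduct.tmul_add, TensorProduct.add_tmul, hx, hy]
    | tmul w b =>
      rw [LinearMap.rTensor_tmul]
      simp only [TensorProduct.assoc_symm_tmul, TensorProduct.assoc_tmul, LinearMap.lTensor_tmul,
        LinearMap.comp_apply, LinearMap.rTensor_tmul, LinearMap.mul'_apply,
        TensorProduct.rightComm_tmul, tensorIdentity_tmul]
      induction W.coact w using TensorProduct.induction_on with
      | zero => simp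
      | add x y hx hy =>
        simp only [map_add, TensorProduct.tmul_add, TensorProduct.add_tmul, hx, hy]
      | tmul w' c =>
        simp only [mulTensor_tmul, TensorProduct.assoc_symm_tmul, TensorProduct.assoc_tmul,
          LinearMap.lTensor_tmul, LinearMap.comp_apply, LinearMap.mul'_apply,
          LinearMap.mulLeft_apply]
        congr 1
        ring
  have h2 := h1 (W.coact w)
  rw [antipode_coact_right] at h2
  simpa [tensorIdentityInv] using h2

/-- Equivariance is automatic because the map is the lift of evaluation at the unit tensored with
`W`. -/
theorem isHom_tensorIdentity :
    IsHom (tensor (cofree k A V₀) W) (cofree k A (V₀ ⊗[k] W.carrier)) (tensorIdentity V₀ W) := by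
  let f : (tensor (cofree k A V₀) W).carrier →ₗ[k] V₀ ⊗[k] W.carrier :=
    TensorProduct.map (cofreeEv k A V₀) (LinearMap.id : W.carrier →ₗ[k] W.carrier)
  have h : cofreeLift (tensor (cofree k A V₀) W) f = tensorIdentity V₀ W := by
    refine TensorProduct.ext' fun x w => ?_
    have h1 := map_mulTensor A (cofreeEv k A V₀) (LinearMap.id : W.carrier →ₗ[k] W.carrier)
      ((cofree k A V₀).coact x) (W.coact w)
    have h2 : (cofreeEv k A V₀).rTensor A ((cofree k A V₀).coact x) = x :=
      LinearMap.congr_fun (cofreeLift_cofreeEv (IsHom.id (cofree k A V₀))) x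
    rw [h2, LinearMap.rTensor_id] at h1
    exact h1
  have h3 := isHom_cofreeLift (tensor (cofree k A V₀) W) f
  rw [h] at h3
  exact h3

end Identity

/-- `I` is a retract of a cofree module, tensoring preserves the retraction, and a cofree module
tensored with `W` is again cofree. -/
theorem IsInjective.tensor {I : RatMod k A} (hI : IsInjective I) (W : RatMod k A) :
    IsInjective (tensor I W) := by
  let e : (RatMod.tensor (cofree k A I.carrier) W).carrier ≃ₗ[k]
      (cofree k A (I.carrier ⊗[k] W.carrier)).carrier :=
    LinearEquiv.ofLinearMap (tensorIdentity I.carrier W) (tensorIdentityInv I.carrier W)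
      (tensorIdentity_comp I.carrier W) (tensorIdentityInv_comp I.carrier W)
  have he : IsHom _ _ e.toLinearMap := isHom_tensorIdentity I.carrier W
  have h1 : IsInjective (RatMod.tensor (cofree k A I.carrier) W) :=
    (isInjective_cofree _).of_retract he he.symm e.symm_comp
  obtain ⟨p, hp, hpi⟩ := hI _ _ (cofreeLift I LinearMap.id) (LinearMap.id : I.carrier →ₗ[k] _)
    (isHom_cofreeLift I _) (coact_injective I) (IsHom.id I)
  refine h1.of_retract (isHom_tensorMap (isHom_cofreeLift I LinearMap.id) (IsHom.id W))
    (isHom_tensorMap hp (IsHom.id W)) ?_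
  have := TensorProduct.map_comp p (LinearMap.id : W.carrier →ₗ[k] W.carrier)
    (cofreeLift I LinearMap.id) (LinearMap.id : W.carrier →ₗ[k] W.carrier)
  rw [hpi, LinearMap.id_comp, TensorProduct.map_id] at this
  exact this.symm

end Tensor

end RatMod

/-! ### Points of the subgroup -/

section Points

variable {k A B T : Type u} [Field k] [CommRing A] [HopfAlgebra k A] [CommRing B]
  [HopfAlgebra k B] (π : A →ₐc[k] B)

theorem pointsMap_mul [CommRing T] [Algebra k T] (r s : WithConv (B →ₐ[k] T)) :
    pointsMap π T (r * s) = pointsMap π T r * pointsMap π T s :=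
  congrArg WithConv.toConv (AlgHom.convMul_comp_bialgHom_distrib r s π)

theorem pointsMap_one [CommRing T] [Algebra k T] : pointsMap π T 1 = 1 := by
  refine WithConv.ext (AlgHom.ext fun a => ?_)
  change algebraMap k T (Coalgebra.counit (π a)) = algebraMap k T (Coalgebra.counit a)
  rw [CoalgHomClass.counit_comp_apply]

theorem pointsMap_inv [CommRing T] [Bialgebra k T] (r : WithConv (B →ₐ[k] T)) :
    (pointsMap π T r)⁻¹ = pointsMap π T r⁻¹ := by
  refine inv_eq_of_mul_eq_one_right ?_
  rw [← pointsMap_mul, mul_inv_cancel, pointsMap_one]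

theorem toConv_comp_pointsMap {T' : Type u} [CommRing T] [Algebra k T] [CommRing T'] [Algebra k T']
    (φ : T →ₐ[k] T') (r : WithConv (B →ₐ[k] T)) :
    WithConv.toConv (φ.comp (pointsMap π T r).ofConv) =
      pointsMap π T' (WithConv.toConv (φ.comp r.ofConv)) := rfl

end Points

namespace RatMod

/-! ### Functions invariant under the subgroup -/

section Invariants

variable {k A B : Type u} [Field k] [CommRing A] [HopfAlgebra k A] [CommRing B]
  [HopfAlgebra k B] (π : A →ₐc[k] B)

/-- The function `a` is invariant under right translation by the subgroup. -/
def RightInvariant (a : A) : Prop :=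
  ∀ (T : Type u) [CommRing T] [Algebra k T] (g : WithConv (A →ₐ[k] T))
    (s : WithConv (B →ₐ[k] T)), (g * pointsMap π T s).ofConv a = g.ofConv a

/-- The function `a` is invariant under left translation by the subgroup. -/
def LeftInvariant (a : A) : Prop :=
  ∀ (T : Type u) [CommRing T] [Algebra k T] (g : WithConv (A →ₐ[k] T))
    (s : WithConv (B →ₐ[k] T)), (pointsMap π T s * g).ofConv a = g.ofConv a

local notation "ι₁" =>
  WithConv.toConv (Algebra.TensorProduct.includeLeft : A →ₐ[k] A ⊗[k] B)
local notation "ι₂" =>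
  WithConv.toConv (Algebra.TensorProduct.includeRight : B →ₐ[k] A ⊗[k] B)

variable {π}

/-- Every pair `(g, s)` is a specialization of the universal pair over `A ⊗ B`. -/
theorem rightInvariant_of_universal {a : A}
    (h : (ι₁ * pointsMap π (A ⊗[k] B) ι₂).ofConv a = (ι₁).ofConv a) : RightInvariant π a := by
  intro T _ _ g s
  let φ : A ⊗[k] B →ₐ[k] T :=
    Algebra.TensorProduct.lift g.ofConv s.ofConv fun _ _ => Commute.all _ _
  have h1 : WithConv.toConv (φ.comp (ι₁).ofConv) = g :=
    WithConv.ext (Algebra.TensorProduct.lift_comp_includeLeft _ _ fun _ _ => Commute.all _ _)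
  have h2 : WithConv.toConv (φ.comp (ι₂).ofConv) = s :=
    WithConv.ext (Algebra.TensorProduct.lift_comp_includeRight _ _ fun _ _ => Commute.all _ _)
  have h3 := congrArg φ h
  have h4 := toConv_comp_mul φ ι₁ (pointsMap π (A ⊗[k] B) ι₂)
  rw [toConv_comp_pointsMap, h1, h2] at h4
  rw [← h4]
  exact h3.trans (AlgHom.congr_fun (congrArg WithConv.ofConv h1) a)

theorem leftInvariant_of_universal {a : A}
    (h : (pointsMap π (A ⊗[k] B) ι₂ * ι₁).ofConv a = (ι₁).ofConv a) : LeftInvariant π a := by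
  intro T _ _ g s
  let φ : A ⊗[k] B →ₐ[k] T :=
    Algebra.TensorProduct.lift g.ofConv s.ofConv fun _ _ => Commute.all _ _
  have h1 : WithConv.toConv (φ.comp (ι₁).ofConv) = g :=
    WithConv.ext (Algebra.TensorProduct.lift_comp_includeLeft _ _ fun _ _ => Commute.all _ _)
  have h2 : WithConv.toConv (φ.comp (ι₂).ofConv) = s :=
    WithConv.ext (Algebra.TensorProduct.lift_comp_includeRight _ _ fun _ _ => Commute.all _ _)
  have h3 := congrArg φ h
  have h4 := toConv_comp_mul φ (pointsMap π (A ⊗[k] B) ι₂) ι₁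
  rw [toConv_comp_pointsMap, h1, h2] at h4
  rw [← h4]
  exact h3.trans (AlgHom.congr_fun (congrArg WithConv.ofConv h1) a)

/-- Write `s g = g (g⁻¹ s g)`; normality puts `g⁻¹ s g` in the subgroup. -/
theorem RightInvariant.leftInvariant (hS : IsNormalSubgroupScheme π) {a : A}
    (ha : RightInvariant π a) : LeftInvariant π a := by
  refine leftInvariant_of_universal ?_
  obtain ⟨t, ht⟩ := hS.normal (A ⊗[k] B) (ι₁)⁻¹ ι₂
  have aux : ∀ {G : Type u} [Group G] (x y z : G), x⁻¹ * y = z * x⁻¹ → y * x = x * z := by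
    intro G _ x y z h
    have := congrArg (fun w => x * w * x) h
    simpa [mul_assoc] using this
  have h : pointsMap π (A ⊗[k] B) ι₂ * ι₁ = ι₁ * pointsMap π (A ⊗[k] B) t :=
    aux ι₁ (pointsMap π (A ⊗[k] B) ι₂) (pointsMap π (A ⊗[k] B) t) ht
  rw [h]
  exact ha _ _ _

theorem LeftInvariant.rightInvariant_antipode {a : A} (ha : LeftInvariant π a) :
    RightInvariant π (HopfAlgebra.antipode k a) := by
  refine rightInvariant_of_universal ?_
  rw [← inv_apply, ← inv_apply]
  have h : (ι₁ * pointsMap π (A ⊗[k] B) ι₂)⁻¹ =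
      pointsMap π (A ⊗[k] B) (ι₂)⁻¹ * (ι₁)⁻¹ := by
    rw [← pointsMap_inv]
    exact mul_inv_rev ι₁ (pointsMap π (A ⊗[k] B) ι₂)
  rw [h]
  exact ha _ _ _

/-- The coaction of the subgroup on the coordinate algebra. -/
noncomputable def restrictedComul (π : A →ₐc[k] B) : A →ₐ[k] A ⊗[k] B :=
  (Algebra.TensorProduct.map (AlgHom.id k A) (π : A →ₐ[k] B)).comp (Bialgebra.comulAlgHom k A)

theorem restrictedComul_eq : restrictedComul π = (ι₁ * pointsMap π (A ⊗[k] B) ι₂).ofConv := by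
  rw [AlgHom.convMul_def, ← AlgHom.comp_assoc, restrictedComul, WithConv.ofConv_toConv]
  congr 1
  ext <;> simp [pointsMap]

theorem RightInvariant.restrictedComul {a : A} (ha : RightInvariant π a) :
    restrictedComul π a = a ⊗ₜ 1 := by
  rw [restrictedComul_eq]
  exact ha _ _ _

theorem rightInvariant_of_restrictedComul {a : A} (ha : RatMod.restrictedComul π a = a ⊗ₜ 1) :
    RightInvariant π a :=
  rightInvariant_of_universal (by rw [← restrictedComul_eq]; exact ha)

/-- The defect of left invariance. -/
noncomputable def leftDefect (π : A →ₐc[k] B) : A →ₗ[k] A ⊗[k] B :=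
  (pointsMap π (A ⊗[k] B) ι₂ * ι₁).ofConv.toLinearMap - (ι₁).ofConv.toLinearMap

theorem leftInvariant_of_leftDefect {a : A} (ha : leftDefect π a = 0) : LeftInvariant π a :=
  leftInvariant_of_universal (sub_eq_zero.1 ha)

theorem rTensor_comul {T : Type u} [CommRing T] [Algebra k T] (g : WithConv (A →ₐ[k] T)) (a : A) :
    g.ofConv.toLinearMap.rTensor A (Coalgebra.comul a) =
      (WithConv.toConv ((Algebra.TensorProduct.includeLeft : T →ₐ[k] T ⊗[k] A).comp g.ofConv) *
        WithConv.toConv (Algebra.TensorProduct.includeRight : A →ₐ[k] T ⊗[k] A)).ofConv a := by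
  have h : (Algebra.TensorProduct.lmul' k).comp (Algebra.TensorProduct.map
      ((Algebra.TensorProduct.includeLeft : T →ₐ[k] T ⊗[k] A).comp g.ofConv)
      (Algebra.TensorProduct.includeRight : A →ₐ[k] T ⊗[k] A)) =
      Algebra.TensorProduct.map g.ofConv (AlgHom.id k A) := by
    ext <;> simp
  exact (AlgHom.congr_fun h (Coalgebra.comul a)).symm

/-- From `a(s x y) = a(x y)`: the first leg of the comultiplication of `a` consists of
left-invariant functions. -/
theorem LeftInvariant.rTensor_leftDefect {a : A} (ha : LeftInvariant π a) :
    (leftDefect π).rTensor A (Coalgebra.comul a) = 0 := by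
  rw [leftDefect, LinearMap.rTensor_sub, LinearMap.sub_apply, sub_eq_zero, rTensor_comul,
    rTensor_comul, toConv_comp_mul, mul_assoc, toConv_comp_pointsMap]
  exact ha _ _ _

end Invariants

/-! ### Injectivity of the coordinate algebra over a finite normal subgroup -/

section Splitting

variable {k A B : Type u} [Field k] [CommRing A] [HopfAlgebra k A] [CommRing B]
  [HopfAlgebra k B] {π : A →ₐc[k] B}

theorem isHom_of_contract [Module.Finite k A] {V W : RatMod k A} (f : V.carrier →ₗ[k] W.carrier)
    (h : ∀ (r : A →ₗ[k] k) v, f (contract V.carrier r (V.coact v)) =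
      contract W.carrier r (W.coact (f v))) : IsHom V W f :=
  LinearMap.ext fun v => eq_of_contract_eq fun r => by
    rw [LinearMap.comp_apply, LinearMap.comp_apply, contract_rTensor, h]

theorem contract_restrictedComul (r : B →ₗ[k] k) (a : A) :
    contract A r (restrictedComul π a) =
      leftShift (r ∘ₗ (π : A →ₐ[k] B).toLinearMap) a := by
  have h : ∀ t : A ⊗[k] A, contract A r (Algebra.TensorProduct.map (AlgHom.id k A)
      (π : A →ₐ[k] B) t) = contract A (r ∘ₗ (π : A →ₐ[k] B).toLinearMap) t := by
    intro t
    induction t using TensorProduct.induction_on with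
    | zero => simp
    | add x y hx hy => simp only [map_add, hx, hy]
    | tmul x y => simp
  exact h _

theorem RightInvariant.leftShift_mul {a : A} (ha : RightInvariant π a) (r : B →ₗ[k] k) (b : A) :
    leftShift (r ∘ₗ (π : A →ₐ[k] B).toLinearMap) (a * b) =
      a * leftShift (r ∘ₗ (π : A →ₐ[k] B).toLinearMap) b := by
  have h : ∀ t : A ⊗[k] B, contract A r ((a ⊗ₜ 1) * t) = a * contract A r t := by
    intro t
    induction t using TensorProduct.induction_on with
    | zero => simp
    | add x y hx hy => simp only [map_add, mul_add, hx, hy]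
    | tmul x y => simp
  rw [← contract_restrictedComul, map_mul, ha.restrictedComul, h, contract_restrictedComul]

theorem isHom_res_regular (π : A →ₐc[k] B) :
    IsHom ((regular k A).res π) (regular k B) (π : A →ₐ[k] B).toLinearMap := by
  have h : ∀ a : A, Coalgebra.comul (R := k) (π a) =
      (π : A →ₐ[k] B).toLinearMap.rTensor B (restrictedComul π a) := by
    intro a
    have h2 : TensorProduct.map (π : A →ₐ[k] B).toLinearMap (π : A →ₐ[k] B).toLinearMap =
        (π : A →ₐ[k] B).toLinearMap.rTensor B ∘ₗ (π : A →ₐ[k] B).toLinearMap.lTensor A := by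
      rw [LinearMap.rTensor_comp_lTensor]
    refine (CoalgHomClass.map_comp_comul_apply π a).symm.trans ?_
    exact LinearMap.congr_fun h2 (Coalgebra.comul a)
  exact LinearMap.ext h

theorem isProjective_regular [Module.Finite k A] : IsProjective (regular k A) := by
  obtain ⟨e⟩ := nonempty_regular_equiv k A
  exact isProjective_of_projective (Module.Projective.of_equiv e.symm)

/-- The coordinate algebra of `H` has a total integral for a finite normal subgroup scheme. -/
theorem exists_total_integral [Module.Finite k B] (hS : IsNormalSubgroupScheme π) :
    ∃ Ψ : B →ₗ[k] A, (∀ b, restrictedComul π (Ψ b) = Ψ.rTensor B (Coalgebra.comul b)) ∧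
      Ψ 1 = 1 := by
  -- Projectivity of `k[S]` gives an equivariant section of `π`. Its value `a` at `1` is invariant
  -- with counit `1` but need not be `1`; the rest of the proof corrects this.
  obtain ⟨φ, hφ, hπφ⟩ := isProjective_regular (k := k) (A := B) _ _ _
    (LinearMap.id : (regular k B).carrier →ₗ[k] (regular k B).carrier) (isHom_res_regular π)
    hS.surjective (IsHom.id _)
  let φ' : B →ₗ[k] A := φ
  have hφ' : ∀ b, restrictedComul π (φ' b) = φ'.rTensor B (Coalgebra.comul b) := hφ.apply
  set a := φ' 1 with ha
  have har : RightInvariant π a := by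
    refine rightInvariant_of_restrictedComul ?_
    rw [ha, hφ', Bialgebra.comul_one, Algebra.TensorProduct.one_def, LinearMap.rTensor_tmul]
  have hal := har.leftInvariant hS
  have hεa : Coalgebra.counit (R := k) a = 1 := by
    have h1 : π a = 1 := LinearMap.congr_fun hπφ (1 : B)
    rw [← CoalgHomClass.counit_comp_apply π a, h1, Bialgebra.counit_one]
  obtain ⟨r, hr⟩ := exists_generalized_inverse (leftDefect π)
  -- A linear projection onto the left-invariant functions, the kernel of `leftDefect`.
  let q : A →ₗ[k] A := LinearMap.id - r ∘ₗ leftDefect π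
  have hq : ∀ x, LeftInvariant π (q x) := fun x => leftInvariant_of_leftDefect (by
    have := LinearMap.congr_fun hr x
    simp only [LinearMap.comp_apply] at this
    simp [q, this])
  have hqa : q.rTensor A (Coalgebra.comul a) = Coalgebra.comul a := by
    simp only [q, LinearMap.rTensor_sub, LinearMap.rTensor_id, LinearMap.rTensor_comp,
      LinearMap.sub_apply, LinearMap.comp_apply, hal.rTensor_leftDefect, map_zero, sub_zero,
      LinearMap.id_apply]
  -- Here `N(x) = S(q(x₁)) x₂`. The factor `S(q(x₁))` is right-invariant, so `N` is equivariant; `q`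
  -- fixes the first leg of the comultiplication of `a`, so `N(a) = S(a₁)a₂ = ε(a) = 1`.
  let m : A ⊗[k] A →ₗ[k] A := LinearMap.mul' k A ∘ₗ (HopfAlgebra.antipode k ∘ₗ q).rTensor A
  let N : A →ₗ[k] A := m ∘ₗ Coalgebra.comul
  have hN : IsHom ((regular k A).res π) ((regular k A).res π) N := by
    refine isHom_of_contract _ fun s x => ?_
    have h1 : ∀ t : A ⊗[k] A, m ((leftShift (s ∘ₗ (π : A →ₐ[k] B).toLinearMap)).lTensor A t) =
        leftShift (s ∘ₗ (π : A →ₐ[k] B).toLinearMap) (m t) := by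
      intro t
      induction t using TensorProduct.induction_on with
      | zero => simp
      | add x y hx hy => simp only [map_add, hx, hy]
      | tmul x y =>
        simp [m, (hq x).rightInvariant_antipode.leftShift_mul]
    have h2 : ∀ y : A, N (contract A s (restrictedComul π y)) =
        contract A s (restrictedComul π (N y)) := by
      intro y
      rw [contract_restrictedComul, contract_restrictedComul, LinearMap.comp_apply,
        comul_leftShift, h1]
      rfl
    exact h2 x
  refine ⟨N ∘ₗ φ', (hN.comp hφ).apply, ?_⟩
  have h3 : ∀ t : A ⊗[k] A, m t =
      LinearMap.mul' k A ((HopfAlgebra.antipode k).rTensor A (q.rTensor A t)) := by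
    intro t
    simp only [m, LinearMap.rTensor_comp, LinearMap.comp_apply]
  change m (Coalgebra.comul a) = 1
  rw [h3, hqa, HopfAlgebra.mul_antipode_rTensor_comul_apply, hεa, map_one]

theorem res_cofree_coact_tmul {V₀ : Type u} [AddCommGroup V₀] [Module k V₀] (π : A →ₐc[k] B)
    (v : V₀) (a : A) : ((cofree k A V₀).res π).coact (v ⊗ₜ[k] a : V₀ ⊗[k] A) =
      (TensorProduct.assoc k V₀ A B).symm (v ⊗ₜ restrictedComul π a) := by
  have h : ∀ t : A ⊗[k] A, (π : A →ₐ[k] B).toLinearMap.lTensor (V₀ ⊗[k] A)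
      ((TensorProduct.assoc k V₀ A A).symm (v ⊗ₜ t)) = (TensorProduct.assoc k V₀ A B).symm
        (v ⊗ₜ Algebra.TensorProduct.map (AlgHom.id k A) (π : A →ₐ[k] B) t) := by
    intro t
    induction t using TensorProduct.induction_on with
    | zero => simp
    | add x y hx hy => simp only [map_add, TensorProduct.tmul_add, hx, hy]
    | tmul x y => simp
  exact h (Coalgebra.comul a)

/-- Cofree modules restrict to injective modules of a finite normal subgroup scheme. -/
theorem isInjective_res_cofree [Module.Finite k B] (hS : IsNormalSubgroupScheme π) (V₀ : Type u)
    [AddCommGroup V₀] [Module k V₀] : IsInjective ((cofree k A V₀).res π) := by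
  obtain ⟨Ψ, hΨ, hΨ1⟩ := exists_total_integral hS
  set X := (cofree k A V₀).res π with hX
  -- The maps `x ↦ 1 ⊗ x` and `b ⊗ (v ⊗ a) ↦ v ⊗ Ψ(b)a` make `X` a retract of `k[S] ⊗ X`, which is
  -- injective.
  let j : X.carrier →ₗ[k] (tensor (regular k B) X).carrier := TensorProduct.mk k B X.carrier 1
  let p' : B ⊗[k] (V₀ ⊗[k] A) →ₗ[k] V₀ ⊗[k] A :=
    TensorProduct.lift (LinearMap.lTensorHom V₀ ∘ₗ LinearMap.mul k A ∘ₗ Ψ)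
  let p : (tensor (regular k B) X).carrier →ₗ[k] X.carrier := p'
  have hp' : ∀ b v a, p' (b ⊗ₜ (v ⊗ₜ a)) = v ⊗ₜ (Ψ b * a) := fun b v a => by simp [p']
  have hj : IsHom X (tensor (regular k B) X) j := by
    refine LinearMap.ext fun x => ?_
    have h1 : ∀ t : X.carrier ⊗[k] B,
        mulTensor B B X.carrier (1 ⊗ₜ 1) t = (TensorProduct.mk k B X.carrier 1).rTensor B t := by
      intro t
      induction t using TensorProduct.induction_on with
      | zero => simp
      | add x y hx hy => simp only [map_add, hx, hy]
      | tmul x y => simp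
    have h2 : Coalgebra.comul (R := k) (1 : B) = 1 ⊗ₜ 1 := Bialgebra.comul_one
    refine Eq.trans ?_ (h1 (X.coact x))
    exact congrArg (fun z => mulTensor B B X.carrier z (X.coact x)) h2
  have hp : IsHom (tensor (regular k B) X) X p := by
    refine TensorProduct.ext (LinearMap.ext fun b => TensorProduct.ext' fun v a => ?_)
    have h1 : ∀ (y : B ⊗[k] B) (z : A ⊗[k] B),
        p'.rTensor B (mulTensor B B (V₀ ⊗[k] A) y
          ((TensorProduct.assoc k V₀ A B).symm (v ⊗ₜ z))) =
        (TensorProduct.assoc k V₀ A B).symm (v ⊗ₜ (Ψ.rTensor B y * z)) := by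
      intro y z
      induction y using TensorProduct.induction_on with
      | zero => simp
      | add x y hx hy =>
        simp only [map_add, LinearMap.add_apply, add_mul, TensorProduct.tmul_add, hx, hy]
      | tmul c d =>
        induction z using TensorProduct.induction_on with
        | zero => simp
        | add x y hx hy => simp only [map_add, mul_add, TensorProduct.tmul_add, hx, hy]
        | tmul x y => simp [hp']
    have h2 : ∀ b : B, X.coact (p' (b ⊗ₜ (v ⊗ₜ a))) = (TensorProduct.assoc k V₀ A B).symm
        (v ⊗ₜ (Ψ.rTensor B (Coalgebra.comul b) * restrictedComul π a)) := by
      intro b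
      rw [hp', ← hΨ, ← map_mul]
      exact res_cofree_coact_tmul π v _
    have h3 := h1 (Coalgebra.comul (b : B)) (restrictedComul π a)
    rw [← res_cofree_coact_tmul] at h3
    exact (h2 b).trans h3.symm
  refine (isProjective_regular.isInjective.tensor X).of_retract hj hp ?_
  refine TensorProduct.ext' fun v a => ?_
  refine (hp' 1 v a).trans ?_
  rw [hΨ1, one_mul]
  rfl

end Splitting

/-! ### Existence and stable uniqueness of syzygies -/

section General

variable {k A : Type u} [Field k] [CommRing A] [HopfAlgebra k A]

local notation "𝓡" => WithConv (A →ₗ[k] k)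

/-- The map between direct sums induced by linear maps over the dual algebra. -/
noncomputable def directSumMap {V W V' W' : RatMod k A} (f : V.carrier →ₗ[𝓡] V'.carrier)
    (g : W.carrier →ₗ[𝓡] W'.carrier) :
    (directSum V W).carrier →ₗ[𝓡] (directSum V' W').carrier :=
  (directSumEquiv V' W').symm.toLinearMap ∘ₗ f.prodMap g ∘ₗ (directSumEquiv V W).toLinearMap

/-- `V` and `W` become isomorphic after adding projective modules. -/
def StablyIso (V W : RatMod k A) : Prop :=
  ∃ X Y : RatMod k A, IsProjective X ∧ IsProjective Y ∧
    Nonempty ((V.carrier × X.carrier) ≃ₗ[𝓡] (W.carrier × Y.carrier))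

theorem IsResolutionKernel.of_iso {n : ℕ} {M L L' : RatMod k A} (h : IsResolutionKernel n M L)
    (e : Iso L L') : IsResolutionKernel n M L' := by
  induction n generalizing M with
  | zero => exact Iso.trans h e
  | succ n ih =>
    obtain ⟨P, M', f, g, hP, hs, hk⟩ := h
    exact ⟨P, M', f, g, hP, hs, ih hk⟩

theorem IsResolutionCokernel.of_iso {n : ℕ} {M L L' : RatMod k A}
    (h : IsResolutionCokernel n M L) (e : Iso L L') : IsResolutionCokernel n M L' := by
  induction n generalizing M with
  | zero => exact Iso.trans h e
  | succ n ih =>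
    obtain ⟨I, M', f, g, hI, hs, hk⟩ := h
    exact ⟨I, M', f, g, hI, hs, ih hk⟩

theorem StablyIso.of_iso {V V' W W' : RatMod k A} (h : StablyIso V W) (e : Iso V V')
    (e' : Iso W W') : StablyIso V' W' := by
  obtain ⟨X, Y, hX, hY, ⟨φ⟩⟩ := h
  obtain ⟨ψ⟩ := e.nonempty_linearEquiv
  obtain ⟨ψ'⟩ := e'.nonempty_linearEquiv
  exact ⟨X, Y, hX, hY, ⟨((ψ.symm.prodCongr (LinearEquiv.refl _ _)).trans φ).trans
    (ψ'.prodCongr (LinearEquiv.refl _ _))⟩⟩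

variable [Module.Finite k A]

instance : IsArtinianRing (WithConv (A →ₗ[k] k)) := by
  have : Module.Finite k (WithConv (A →ₗ[k] k)) :=
    Module.Finite.equiv (WithConv.linearEquiv k (A →ₗ[k] k)).symm
  exact IsArtinianRing.of_finite k _

theorem IsProjective.directSum {P Q : RatMod k A} (hP : IsProjective P) (hQ : IsProjective Q) :
    IsProjective (directSum P Q) := by
  have := hP.projective
  have := hQ.projective
  exact isProjective_of_projective (Module.Projective.of_equiv (directSumEquiv P Q).symm)

theorem StablyIso.refl (V : RatMod k A) : StablyIso V V :=
  ⟨_, _, isProjective_regular, isProjective_regular, ⟨LinearEquiv.refl _ _⟩⟩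

/-- Kernels in projective resolutions are unique up to stable isomorphism. -/
theorem IsResolutionKernel.stablyIso {n : ℕ} {M M' L L' : RatMod k A}
    (h : IsResolutionKernel n M L) (h' : IsResolutionKernel n M' L') (hM : StablyIso M M') :
    StablyIso L L' := by
  induction n generalizing M M' with
  | zero => exact hM.of_iso h h'
  | succ n ih =>
    obtain ⟨P, M₁, f, g, hP, hs, hk⟩ := h
    obtain ⟨P', M₁', f', g', hP', hs', hk'⟩ := h'
    refine ih hk hk' ?_
    obtain ⟨X, Y, hX, hY, ⟨e⟩⟩ := hM
    have := hP.projective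
    have := hP'.projective
    have := hX.projective
    have := hY.projective
    -- Adding `X` and `Y` to the covers makes both end in `M' ⊕ Y` without changing the kernels, so
    -- Schanuel's lemma applies.
    let G : (P.carrier × X.carrier) →ₗ[𝓡] (M'.carrier × Y.carrier) :=
      e.toLinearMap ∘ₗ hs.hom_right.toDual.prodMap LinearMap.id
    let G' : (P'.carrier × Y.carrier) →ₗ[𝓡] (M'.carrier × Y.carrier) :=
      hs'.hom_right.toDual.prodMap LinearMap.id
    let F : M₁.carrier →ₗ[𝓡] (P.carrier × X.carrier) :=
      LinearMap.inl _ _ _ ∘ₗ hs.hom_left.toDual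
    let F' : M₁'.carrier →ₗ[𝓡] (P'.carrier × Y.carrier) :=
      LinearMap.inl _ _ _ ∘ₗ hs'.hom_left.toDual
    have hG : Function.Surjective G :=
      e.surjective.comp (hs.surjective.prodMap Function.surjective_id)
    have hG' : Function.Surjective G' := hs'.surjective.prodMap Function.surjective_id
    have hF : Function.Injective F := fun x y hxy => hs.injective (congrArg Prod.fst hxy)
    have hF' : Function.Injective F' := fun x y hxy => hs'.injective (congrArg Prod.fst hxy)
    have hFG : Function.Exact F G := by
      rintro ⟨p, x⟩
      refine (e.map_eq_zero_iff (x := (g p, x))).trans ?_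
      constructor
      · intro h
        obtain ⟨m, hm⟩ := (hs.exact p).1 (congrArg Prod.fst h)
        exact ⟨m, Prod.ext hm (congrArg Prod.snd h).symm⟩
      · rintro ⟨m, hm⟩
        exact Prod.ext ((hs.exact p).2 ⟨m, congrArg Prod.fst hm⟩) (congrArg Prod.snd hm).symm
    have hFG' : Function.Exact F' G' := by
      rintro ⟨p, x⟩
      constructor
      · intro h
        obtain ⟨m, hm⟩ := (hs'.exact p).1 (congrArg Prod.fst h)
        exact ⟨m, Prod.ext hm (congrArg Prod.snd h).symm⟩
      · rintro ⟨m, hm⟩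
        exact Prod.ext ((hs'.exact p).2 ⟨m, congrArg Prod.fst hm⟩) (congrArg Prod.snd hm).symm
    obtain ⟨s, hs1⟩ := Module.projective_lifting_property G G' hG
    obtain ⟨s', hs1'⟩ := Module.projective_lifting_property G' G hG'
    obtain ⟨φ⟩ := schanuel hF hF' hFG hFG' s s' hs1 hs1'
    exact ⟨_, _, hP'.directSum hY, hP.directSum hX,
      ⟨(((LinearEquiv.refl _ _).prodCongr (directSumEquiv P' Y)).trans φ).trans
        ((LinearEquiv.refl _ _).prodCongr (directSumEquiv P X).symm)⟩⟩

/-- Cokernels in injective resolutions are unique up to stable isomorphism. -/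
theorem IsResolutionCokernel.stablyIso {n : ℕ} {M M' L L' : RatMod k A}
    (h : IsResolutionCokernel n M L) (h' : IsResolutionCokernel n M' L') (hM : StablyIso M M') :
    StablyIso L L' := by
  induction n generalizing M M' with
  | zero => exact hM.of_iso h h'
  | succ n ih =>
    obtain ⟨I, C, f, g, hI, hs, hk⟩ := h
    obtain ⟨I', C', f', g', hI', hs', hk'⟩ := h'
    refine ih hk hk' ?_
    obtain ⟨X, Y, hX, hY, ⟨e₀⟩⟩ := hM
    -- Sums are formed as rational modules because injectivity is stated for those; the projectives
    -- `X` and `Y` may be added since they are also injective.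
    let e : (directSum M X).carrier ≃ₗ[𝓡] (directSum M' Y).carrier :=
      ((directSumEquiv M X).trans e₀).trans (directSumEquiv M' Y).symm
    have hIX := (hI.isProjective.directSum hX).isInjective
    have hIY := (hI'.isProjective.directSum hY).isInjective
    let F₀ : (directSum M X).carrier →ₗ[𝓡] (directSum I X).carrier :=
      directSumMap hs.hom_left.toDual LinearMap.id
    let F : (directSum M' Y).carrier →ₗ[𝓡] (directSum I X).carrier := F₀ ∘ₗ e.symm.toLinearMap
    let F' : (directSum M' Y).carrier →ₗ[𝓡] (directSum I' Y).carrier :=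
      directSumMap hs'.hom_left.toDual LinearMap.id
    let G : (directSum I X).carrier →ₗ[𝓡] C.carrier :=
      hs.hom_right.toDual ∘ₗ (isHom_fst I X).toDual
    let G' : (directSum I' Y).carrier →ₗ[𝓡] C'.carrier :=
      hs'.hom_right.toDual ∘ₗ (isHom_fst I' Y).toDual
    have hG : Function.Surjective G := hs.surjective.comp Prod.fst_surjective
    have hG' : Function.Surjective G' := hs'.surjective.comp Prod.fst_surjective
    have hF : Function.Injective F :=
      Function.Injective.comp (g := F₀) (hs.injective.prodMap Function.injective_id)
        e.symm.injective
    have hF' : Function.Injective F' := hs'.injective.prodMap Function.injective_id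
    have hFG₀ : Function.Exact F₀ G := by
      rintro ⟨p, x⟩
      constructor
      · intro h
        obtain ⟨m, hm⟩ := (hs.exact p).1 h
        exact ⟨((m, x) : M.carrier × X.carrier), Prod.ext hm rfl⟩
      · rintro ⟨⟨m, y⟩, hm⟩
        exact (hs.exact p).2 ⟨m, congrArg Prod.fst hm⟩
    have hFG : Function.Exact F G := by
      intro z
      refine (hFG₀ z).trans ?_
      constructor
      · rintro ⟨m, rfl⟩
        exact ⟨e m, congrArg F₀ (e.symm_apply_apply m)⟩
      · rintro ⟨m, rfl⟩
        exact ⟨e.symm m, rfl⟩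
    have hFG' : Function.Exact F' G' := by
      rintro ⟨p, x⟩
      constructor
      · intro h
        obtain ⟨m, hm⟩ := (hs'.exact p).1 h
        exact ⟨((m, x) : M'.carrier × Y.carrier), Prod.ext hm rfl⟩
      · rintro ⟨⟨m, y⟩, hm⟩
        exact (hs'.exact p).2 ⟨m, congrArg Prod.fst hm⟩
    obtain ⟨s, hsh, hs1⟩ := hIY _ _ (F.restrictScalars k) (F'.restrictScalars k)
      (isHom_restrictScalars F) hF (isHom_restrictScalars F')
    obtain ⟨s', hsh', hs1'⟩ := hIX _ _ (F'.restrictScalars k) (F.restrictScalars k)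
      (isHom_restrictScalars F') hF' (isHom_restrictScalars F)
    obtain ⟨φ⟩ := schanuel_dual hG hG' hFG hFG' hsh.toDual hsh'.toDual
      (LinearMap.ext fun x => LinearMap.congr_fun hs1 x)
      (LinearMap.ext fun x => LinearMap.congr_fun hs1' x)
    exact ⟨_, _, hI'.isProjective.directSum hY, hI.isProjective.directSum hX, ⟨φ⟩⟩

/-- A rational module that is the internal direct sum of two modules is their direct sum. -/
theorem iso_directSum {V X Y : RatMod k A} {f : X.carrier →ₗ[k] V.carrier}
    {g : Y.carrier →ₗ[k] V.carrier} (hf : IsHom X V f) (hg : IsHom Y V g)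
    (hinj : ∀ x y, f x + g y = 0 → x = 0 ∧ y = 0) (hsurj : ∀ v, ∃ x y, f x + g y = v) :
    Iso V (directSum X Y) := by
  let F : (X.carrier × Y.carrier) →ₗ[𝓡] V.carrier := hf.toDual.coprod hg.toDual
  have hF : Function.Bijective F := by
    constructor
    · rw [injective_iff_map_eq_zero]
      rintro ⟨x, y⟩ h
      obtain ⟨h1, h2⟩ := hinj x y h
      rw [h1, h2]; rfl
    · intro v
      obtain ⟨x, y, h⟩ := hsurj v
      exact ⟨(x, y), h⟩
  exact iso_of_linearEquiv ((LinearEquiv.ofBijective F hF).symm.trans (directSumEquiv X Y).symm)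

/-- A split monomorphism is the inclusion of a direct summand. -/
theorem exists_iso_directSum_of_split {K N : RatMod k A} (i : N.carrier →ₗ[𝓡] K.carrier)
    (g : K.carrier →ₗ[𝓡] N.carrier) (hgi : g ∘ₗ i = LinearMap.id) :
    ∃ C : RatMod k A, Nonempty (C.carrier ≃ₗ[𝓡] LinearMap.ker g) ∧ Iso K (directSum N C) := by
  obtain ⟨C, j, hj, hji, hex⟩ := exists_kernel (isHom_restrictScalars g)
  have hgi' : ∀ n, g (i n) = n := LinearMap.congr_fun hgi
  have hgj : ∀ c, g (j c) = 0 := hex.apply_apply_eq_zero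
  refine ⟨C, ?_, iso_directSum (isHom_restrictScalars i) hj ?_ ?_⟩
  · have hr : LinearMap.range hj.toDual = LinearMap.ker g := by
      ext x
      exact (hex x).symm
    exact ⟨(LinearEquiv.ofInjective hj.toDual hji).trans (LinearEquiv.ofEq _ _ hr)⟩
  · intro n c h
    have h1 : g (i n + j c) = 0 := by rw [← map_zero g]; exact congrArg g h
    rw [map_add, hgi', hgj, add_zero] at h1
    subst h1
    have h2 : j c = 0 := by
      have h3 : i 0 + j c = 0 := h
      rwa [map_zero, zero_add] at h3
    exact ⟨rfl, hji (h2.trans (map_zero j).symm)⟩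
  · intro v
    have h1 : g (v - i (g v)) = 0 := by rw [map_sub, hgi', sub_self]
    obtain ⟨c, hc⟩ := (hex _).1 h1
    refine ⟨g v, c, ?_⟩
    rw [hc]
    exact add_sub_cancel _ _

/-- An idempotent splits `N` as `ker u ⊕ ker (1 - u)`, the second being the range. This is the form
of the hypothesis used over Artinian rings. -/
theorem NoProjectiveSummand.eq_zero {N : RatMod k A} (hN : NoProjectiveSummand N)
    (u : N.carrier →ₗ[𝓡] N.carrier) (hu : u ∘ₗ u = u)
    (hp : Module.Projective 𝓡 (LinearMap.range u)) : u = 0 := by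
  have hu' : ∀ n, u (u n) = u n := LinearMap.congr_fun hu
  obtain ⟨X, i, hi, hii, hX⟩ := exists_kernel (isHom_restrictScalars u)
  obtain ⟨Q, j, hj, hji, hQ⟩ := exists_kernel (isHom_restrictScalars (LinearMap.id - u))
  have hui : ∀ x, u (i x) = 0 := hX.apply_apply_eq_zero
  have huj : ∀ x, u (j x) = j x := fun x => (sub_eq_zero.1 (hQ.apply_apply_eq_zero x)).symm
  have hr : LinearMap.range hj.toDual = LinearMap.range u := by
    ext x
    constructor
    · rintro ⟨y, rfl⟩
      exact ⟨j y, huj y⟩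
    · rintro ⟨y, rfl⟩
      exact (hQ (u y)).1 (sub_eq_zero.2 (hu' y).symm)
  have hQp : IsProjective Q := isProjective_of_projective (Module.Projective.of_equiv
    ((LinearEquiv.ofInjective hj.toDual hji).trans (LinearEquiv.ofEq _ _ hr)).symm)
  have hiso : Iso N (directSum X Q) := by
    refine iso_directSum hi hj ?_ ?_
    · intro x y h
      have h1 : u (i x + j y) = 0 := by rw [h, map_zero]
      rw [map_add, hui, huj, zero_add] at h1
      rw [h1, add_zero] at h
      exact ⟨hii (h.trans (map_zero i).symm), hji (h1.trans (map_zero j).symm)⟩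
    · intro n
      obtain ⟨x, hx⟩ := (hX (n - u n)).1 (by
        change u (n - u n) = 0
        rw [map_sub, hu', sub_self])
      obtain ⟨y, hy⟩ := (hQ (u n)).1 (sub_eq_zero.2 (hu' n).symm)
      exact ⟨x, y, by rw [hx, hy, sub_add_cancel]⟩
  have := hN X Q hQp hiso
  ext n
  obtain ⟨y, hy⟩ := (hQ (u n)).1 (sub_eq_zero.2 (hu' n).symm)
  rw [← hy, Subsingleton.elim y 0, map_zero, LinearMap.zero_apply]

/-- A module without projective summands is a summand of every module stably isomorphic to it. -/
theorem NoProjectiveSummand.exists_iso {N Q K : RatMod k A} (hN : NoProjectiveSummand N)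
    (hQ : IsProjective Q) (h : StablyIso (directSum N Q) K) :
    ∃ C : RatMod k A, IsProjective C ∧ Iso K (directSum N C) := by
  obtain ⟨X, Y, hX, hY, ⟨φ⟩⟩ := h
  have := hQ.projective
  have := hX.projective
  have := hY.projective
  obtain ⟨i, g, hgi, hg⟩ := exists_split_of_stably_equiv hN.eq_zero
    (((LinearEquiv.prodAssoc 𝓡 N.carrier Q.carrier X.carrier).symm.trans
      ((directSumEquiv N Q).symm.prodCongr (LinearEquiv.refl _ _))).trans φ)
  obtain ⟨C, ⟨e⟩, hC⟩ := exists_iso_directSum_of_split i g hgi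
  exact ⟨C, isProjective_of_projective (Module.Projective.of_equiv e.symm), hC⟩

/-- A finite-dimensional module is the direct sum of a projective module and a module without
projective summands. -/
theorem exists_noProjectiveSummand (L : RatMod k A) [Module.Finite k L.carrier] :
    ∃ N Q : RatMod k A, NoProjectiveSummand N ∧ IsProjective Q ∧ Iso L (directSum N Q) := by
  induction hd : Module.finrank k L.carrier using Nat.strong_induction_on generalizing L with
  | _ d ih =>
    by_cases hL : NoProjectiveSummand L
    -- The cofree module on the zero space serves as the zero module.
    · refine ⟨L, cofree k A PUnit.{u+1}, hL, isProjective_of_projective (projective_cofree _), ?_⟩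
      have : Subsingleton (cofree k A PUnit.{u+1}).carrier :=
        inferInstanceAs (Subsingleton (PUnit.{u+1} ⊗[k] A))
      have : Unique (cofree k A PUnit.{u+1}).carrier := ⟨⟨0⟩, fun _ => Subsingleton.elim _ _⟩
      exact iso_of_linearEquiv ((LinearEquiv.prodUnique).symm.trans (directSumEquiv _ _).symm)
    · unfold NoProjectiveSummand at hL
      push Not at hL
      obtain ⟨X, Q, hQ, hiso, hQ0⟩ := hL
      obtain ⟨e, he⟩ := id hiso
      have hfin : Module.Finite k (X.carrier × Q.carrier) := Module.Finite.equiv e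
      have hX : Module.Finite k X.carrier :=
        Module.Finite.of_surjective (LinearMap.fst k X.carrier Q.carrier) Prod.fst_surjective
      have hQf : Module.Finite k Q.carrier :=
        Module.Finite.of_surjective (LinearMap.snd k X.carrier Q.carrier) Prod.snd_surjective
      have hlt : Module.finrank k X.carrier < d := by
        have h1 : Module.finrank k L.carrier = Module.finrank k (X.carrier × Q.carrier) :=
          e.finrank_eq
        rw [Module.finrank_prod] at h1
        have := Module.finrank_pos (R := k) (M := Q.carrier)
        omega
      obtain ⟨N, Q', hN, hQ', h⟩ := ih _ hlt X rfl
      refine ⟨N, directSum Q' Q, hN, hQ'.directSum hQ, ?_⟩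
      obtain ⟨φ⟩ := hiso.nonempty_linearEquiv
      obtain ⟨ψ⟩ := h.nonempty_linearEquiv
      exact iso_of_linearEquiv (((((φ.trans (directSumEquiv X Q)).trans
        ((ψ.trans (directSumEquiv N Q')).prodCongr (LinearEquiv.refl _ _))).trans
        (LinearEquiv.prodAssoc 𝓡 N.carrier Q'.carrier Q.carrier)).trans
        ((LinearEquiv.refl _ _).prodCongr (directSumEquiv Q' Q).symm)).trans
        (directSumEquiv N (directSum Q' Q)).symm)

/-- Cofree covers of finite-dimensional modules are finite-dimensional, so projective summands of
the kernel can be split off by induction on dimension. -/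
theorem exists_finite_resolutionKernel (n : ℕ) (M : RatMod k A) [Module.Finite k M.carrier] :
    ∃ L : RatMod k A, Module.Finite k L.carrier ∧ IsResolutionKernel n M L := by
  induction n generalizing M with
  | zero => exact ⟨M, ‹_›, Iso.refl M⟩
  | succ n ih =>
    obtain ⟨g, hg, hgs⟩ := exists_surjective_cofree M
    obtain ⟨K, i, hi, hii, hex⟩ := exists_kernel hg
    have h1 : Module.Finite k (cofree k A M.carrier).carrier :=
      inferInstanceAs (Module.Finite k (M.carrier ⊗[k] A))
    have h2 : Module.Finite k K.carrier := Module.Finite.of_injective i hii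
    obtain ⟨L, hL, h⟩ := ih K
    exact ⟨L, hL, _, K, i, g, isProjective_of_projective (projective_cofree _),
      ⟨hi, hg, hii, hex, hgs⟩, h⟩

theorem exists_finite_resolutionCokernel (n : ℕ) (M : RatMod k A) [Module.Finite k M.carrier] :
    ∃ L : RatMod k A, Module.Finite k L.carrier ∧ IsResolutionCokernel n M L := by
  induction n generalizing M with
  | zero => exact ⟨M, ‹_›, Iso.refl M⟩
  | succ n ih =>
    obtain ⟨C, p, hp, hps, hex⟩ := exists_cokernel (isHom_cofreeLift M LinearMap.id)
    have h1 : Module.Finite k (cofree k A M.carrier).carrier :=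
      inferInstanceAs (Module.Finite k (M.carrier ⊗[k] A))
    have h2 : Module.Finite k C.carrier := Module.Finite.of_surjective p hps
    obtain ⟨L, hL, h⟩ := ih C
    exact ⟨L, hL, _, C, _, p, isInjective_cofree _,
      ⟨isHom_cofreeLift M LinearMap.id, hp, coact_injective M, hex, hps⟩, h⟩

theorem exists_isSyzygy (n : ℤ) (M : RatMod k A) [Module.Finite k M.carrier] :
    ∃ N : RatMod k A, IsSyzygy n M N := by
  cases n with
  | ofNat m =>
    obtain ⟨L, hL, h⟩ := exists_finite_resolutionKernel m M
    obtain ⟨N, Q, hN, hQ, e⟩ := exists_noProjectiveSummand L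
    exact ⟨N, hN, Q, hQ, h.of_iso e⟩
  | negSucc m =>
    obtain ⟨L, hL, h⟩ := exists_finite_resolutionCokernel (m + 1) M
    obtain ⟨N, Q, hN, hQ, e⟩ := exists_noProjectiveSummand L
    exact ⟨N, hN, Q, hQ, h.of_iso e⟩

end General

/-! ### Resolutions by modules of the large group -/

section Lifting

variable {k A B : Type u} [Field k] [CommRing A] [HopfAlgebra k A] [CommRing B]
  [HopfAlgebra k B] {π : A →ₐc[k] B}

/-- An augmentation of `P` induces a homomorphism `P ⊗ M → M`. -/
noncomputable def augment {P : RatMod k A} (ε : P.carrier →ₗ[k] k) (M : RatMod k A) :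
    (tensor P M).carrier →ₗ[k] M.carrier :=
  (TensorProduct.lid k M.carrier).toLinearMap ∘ₗ TensorProduct.map ε LinearMap.id

theorem augment_tmul {P : RatMod k A} (ε : P.carrier →ₗ[k] k) (M : RatMod k A) (p : P.carrier)
    (m : M.carrier) : augment ε M (p ⊗ₜ[k] m : P.carrier ⊗[k] M.carrier) = ε p • m :=
  TensorProduct.lid_tmul _ _

theorem isHom_augment {P : RatMod k A} {ε : P.carrier →ₗ[k] k} (hε : IsHom P (triv k A) ε)
    (M : RatMod k A) : IsHom (tensor P M) M (augment ε M) := by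
  refine TensorProduct.ext' fun p m => ?_
  have h1 : ε.rTensor A (P.coact p) = ε p ⊗ₜ 1 := (hε.apply p).symm
  have h2 := map_mulTensor A ε (LinearMap.id : M.carrier →ₗ[k] M.carrier) (P.coact p) (M.coact m)
  rw [h1, LinearMap.rTensor_id, LinearMap.id_apply] at h2
  have h3 : ∀ t : M.carrier ⊗[k] A, (TensorProduct.lid k M.carrier).toLinearMap.rTensor A
      (mulTensor A k M.carrier (ε p ⊗ₜ 1) t) = ε p • t := by
    intro t
    induction t using TensorProduct.induction_on with
    | zero => simp
    | add x y hx hy => simp only [map_add, smul_add, hx, hy]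
    | tmul x y => simp [TensorProduct.smul_tmul']
  have h4 : (augment ε M).rTensor A (mulTensor A P.carrier M.carrier (P.coact p) (M.coact m)) =
      ε p • M.coact m := by
    rw [← h3, ← h2]
    exact LinearMap.congr_fun (LinearMap.rTensor_comp A
      (TensorProduct.lid k M.carrier).toLinearMap
      (TensorProduct.map ε (LinearMap.id : M.carrier →ₗ[k] M.carrier))) _
  refine Eq.trans ?_ h4.symm
  refine (congrArg M.coact (augment_tmul ε M p m)).trans ?_
  exact map_smul M.coact _ _

theorem augment_surjective {P : RatMod k A} {ε : P.carrier →ₗ[k] k} (hε : Function.Surjective ε)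
    (M : RatMod k A) : Function.Surjective (augment ε M) := by
  intro m
  obtain ⟨p, hp⟩ := hε 1
  exact ⟨(p ⊗ₜ[k] m : P.carrier ⊗[k] M.carrier), (augment_tmul ε M p m).trans (by rw [hp, one_smul])⟩

theorem IsShortExact.res (π : A →ₐc[k] B) {X Y Z : RatMod k A} {f : X.carrier →ₗ[k] Y.carrier}
    {g : Y.carrier →ₗ[k] Z.carrier} (h : IsShortExact X Y Z f g) :
    IsShortExact (X.res π) (Y.res π) (Z.res π) f g :=
  ⟨h.hom_left.res π, h.hom_right.res π, h.injective, h.exact, h.surjective⟩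

variable [Module.Finite k B]

/-- Restriction commutes with tensor products, and over the finite group scheme projectives are the
injectives, which absorb tensor products. -/
theorem isProjective_res_tensor {P : RatMod k A} (hP : IsProjective (P.res π)) (M : RatMod k A) :
    IsProjective ((tensor P M).res π) :=
  ((hP.isInjective.tensor (M.res π)).of_retract (isHom_res_tensor π P M) (isHom_tensor_res π P M)
    (LinearMap.id_comp _)).isProjective

/-- The kernel of `P ⊗ M → M` is again a module of the large group, so the same cover can be used at
every step. -/
theorem exists_lift_resolutionKernel {P : RatMod k A} (hP : IsProjective (P.res π))
    {ε : P.carrier →ₗ[k] k} (hε : IsHom P (triv k A) ε) (hεs : Function.Surjective ε) (n : ℕ)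
    (M : RatMod k A) : ∃ K : RatMod k A, IsResolutionKernel n (M.res π) (K.res π) := by
  induction n generalizing M with
  | zero => exact ⟨M, Iso.refl _⟩
  | succ n ih =>
    obtain ⟨K₁, i, hi, hii, hex⟩ := exists_kernel (isHom_augment hε M)
    obtain ⟨K, hK⟩ := ih K₁
    have hs : IsShortExact K₁ (tensor P M) M i (augment ε M) :=
      ⟨hi, isHom_augment hε M, hii, hex, augment_surjective hεs M⟩
    exact ⟨K, _, _, _, _, isProjective_res_tensor hP M, hs.res π, hK⟩

/-- The coaction embeds `M` in `M ⊗ k[H]`, which stays injective on restriction, and the cokernel is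
again a module of the large group. -/
theorem exists_lift_resolutionCokernel (hS : IsNormalSubgroupScheme π) (n : ℕ)
    (M : RatMod k A) : ∃ K : RatMod k A, IsResolutionCokernel n (M.res π) (K.res π) := by
  induction n generalizing M with
  | zero => exact ⟨M, Iso.refl _⟩
  | succ n ih =>
    obtain ⟨C, p, hp, hps, hex⟩ := exists_cokernel (isHom_cofreeLift M LinearMap.id)
    obtain ⟨K, hK⟩ := ih C
    have hs : IsShortExact M (cofree k A M.carrier) C (cofreeLift M LinearMap.id) p :=
      ⟨isHom_cofreeLift M LinearMap.id, hp, coact_injective M, hex, hps⟩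
    exact ⟨K, _, _, _, _, isInjective_res_cofree hS _, hs.res π, hK⟩

end Lifting

end RatMod

/-- Here `A = k[H]` and `B = k[S]` are the coordinate algebras of `H` and `S`. -/
theorem mainTheorem8 {k A B : Type u} [Field k] [CommRing A] [HopfAlgebra k A]
    [CommRing B] [HopfAlgebra k B] [Module.Finite k B]
    (π : A →ₐc[k] B) (hS : IsNormalSubgroupScheme π)
    (P : RatMod k A) (hP : (P.res π).IsProjective)
    (ε : P.carrier →ₗ[k] k) (hε : RatMod.IsHom P (RatMod.triv k A) ε)
    (hεs : Function.Surjective ε)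
    (M : RatMod k A) (hM : Module.Finite k M.carrier) (n : ℤ) :
    (∃ N : RatMod k B, RatMod.IsSyzygy n (M.res π) N) ∧
      ∀ N : RatMod k B, RatMod.IsSyzygy n (M.res π) N → RatMod.StablyLifts π N := by
  have hMf : Module.Finite k (M.res π).carrier := hM
  refine ⟨RatMod.exists_isSyzygy n (M.res π), ?_⟩
  rintro N ⟨hN, Q, hQ, h⟩
  cases n with
  | ofNat m =>
    obtain ⟨K, hK⟩ := RatMod.exists_lift_resolutionKernel hP hε hεs m M
    obtain ⟨C, hC, e⟩ := hN.exists_iso hQ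
      (RatMod.IsResolutionKernel.stablyIso h hK (RatMod.StablyIso.refl _))
    exact ⟨K, C, hC, e⟩
  | negSucc m =>
    obtain ⟨K, hK⟩ := RatMod.exists_lift_resolutionCokernel hS (m + 1) M
    obtain ⟨C, hC, e⟩ := hN.exists_iso hQ
      (RatMod.IsResolutionCokernel.stablyIso h hK (RatMod.StablyIso.refl _))
    exact ⟨K, C, hC, e⟩
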